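/- Let $m_1,m_2,r_1,r_2,g>0$ be real numbers. Consider the state space $V=(\mathbb R/2\pi\mathbb Z)^2\times\mathbb R^2$ with coordinates $z=(\theta_1,\theta_2,\omega_1,\omega_2)$, put $$\Delta(\theta)=r_1r_2\,[m_1+m_2\sin^2(\theta_1-\theta_2)]>0 ,$$ and consider on $V$ the vector fields of the control system $\dot z=f(z)+h(z)u(t)$ (a planar double inverted pendulum on a cart), $$f(z)=\frac1{\Delta(\theta)}\begin{pmatrix}\omega_1\Delta(\theta)\\ \omega_2\Delta(\theta)\\ -g r_2[m_2\sin\theta_2\cos(\theta_1-\theta_2)-(m_1+m_2)\sin\theta_1]\\ -g r_1(m_1+m_2)[\cos(\theta_1-\theta_2)\sin\theta_1-\sin\theta_2]\end{pmatrix}+\frac{\sin(\theta_1-\theta_2)}{\Delta(\theta)}\begin{pmatrix}0\\0\\-m_2r_2[r_1\cos(\theta_1-\theta_2)\omega_1^2+r_2\omega_2^2]\\ r_1[r_1(m_1+m_2)\omega_1^2+r_2m_2\cos(\theta_1-\theta_2)\omega_2^2]\end{pmatrix},$$ $$h(z)=\frac{m_2}{\Delta(\theta)}\begin{pmatrix}0\\0\\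 r_2[r_1m_2\cos(\theta_1-\theta_2)-r_2m_1]\\ r_1[r_2m_1\cos(\theta_1-\theta_2)-r_1(m_1+m_2)]\end{pmatrix}.$$ Let $\mathcal F=\{X_1,X_2,X_3,X_4\}$, where $X_1=\Delta f$, $X_2=\Delta h$, $X_3=[X_1,X_2]$, $X_4=[X_2,X_3]$ and $[X,Y]=DY\cdot X-DX\cdot Y$. For $p\in V$, let the orbit $\mathcal O_p(\mathcal F)$ be the set of all points reached from $p$ by following finitely many flows $e^{t_jY_j}$ with $Y_j\in\mathcal F$ and $t_j\in\mathbb R$, and let the attainable set $\mathcal A_p(\mathcal F)$ be the set of those reached with all $t_j\ge 0$. Let $\mathrm{Lie}(\mathcal F)$ be the real linear span of all iterated brackets $[Y_1,[\dots[Y_{k-1},Y_k]\dots]]$ with $k\ge1$ and $Y_j\in\mathcal F$. The family $\mathcal F$ is bracket-generating if, for every $q\in V$, the values at $q$ of the fields in $\mathrm{Lie}(\mathcal F)$ form the whole tangent space $T_qV$. Theorem. If $\mathcal F$ is bracket-generating, then $\mathcal A_p(\mathcal F)=\mathcal O_p(\mathcal F)$ for every $p\in V$. -/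

import Mathlib

namespace Pendulum

/-- Coordinates `z = (θ₁, θ₂, ω₁, ω₂)`, with the angles lifted to `ℝ`. -/
abbrev Coord : Type := Fin 4 → ℝ

/-- The state space `V = (ℝ/2πℤ)² × ℝ²`: two angles and two angular velocities. -/
abbrev State : Type := Real.Angle × Real.Angle × ℝ × ℝ

/-- The covering map `ℝ⁴ → V`. -/
noncomputable def toState (z : Coord) : State := ((z 0 : Real.Angle), (z 1 : Real.Angle), z 2, z 3)

/-! ### Geometric control theory on `V`

The tangent bundle of `V` is trivialised by the frame `∂θ₁, ∂θ₂, ∂ω₁, ∂ω₂`. A vector field on `V` is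
written as the function `X : ℝ⁴ → ℝ⁴` of its components in this frame, in the coordinates `z`; such
a function comes from `V` when it takes equal values at any two points with the same image under
`toState` (see `eq_of_toState_eq` for the fields used here). Lie brackets, tangent vectors and
integral curves on `V` are computed in these coordinates. -/

/-- `q = p ∘ e^{tX}`: the flow of `X` leads in time `t` from `p` to `q` (for negative `t`, it is
followed backwards). -/
def FlowsTo (X : Coord → Coord) (t : ℝ) (p q : State) : Prop :=
  ∃ γ : ℝ → Coord, IsIntegralCurve γ (fun _ => X) ∧ toState (γ 0) = p ∧ toState (γ t) = q

/-- The orbit of the family `F` through `p`: all points obtained from `p` by finitely many flows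
of fields in `F`, in positive or negative times. -/
def orbit (F : Set (Coord → Coord)) (p : State) : Set State :=
  {q | Relation.ReflTransGen (fun a b => ∃ X ∈ F, ∃ t : ℝ, FlowsTo X t a b) p q}

/-- The attainable set of the family `F` from `p`: all points obtained from `p` by finitely many
flows of fields in `F`, in nonnegative times only. -/
def attainableSet (F : Set (Coord → Coord)) (p : State) : Set State :=
  {q | Relation.ReflTransGen (fun a b => ∃ X ∈ F, ∃ t : ℝ, 0 ≤ t ∧ FlowsTo X t a b) p q}

/-- The iterated brackets `[X₁, [… [X_{k-1}, X_k] …]]`, `k ≥ 1`, of elements of `F`. Here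
`[X, Y] = DY · X - DX · Y`. -/
inductive IsIteratedBracket (F : Set (Coord → Coord)) : (Coord → Coord) → Prop
  | base {X : Coord → Coord} (hX : X ∈ F) : IsIteratedBracket F X
  | bracket {X Y : Coord → Coord} (hX : X ∈ F) (hY : IsIteratedBracket F Y) :
      IsIteratedBracket F (VectorField.lieBracket ℝ X Y)

/-- `Lie(F)`: the real linear span of the iterated brackets of elements of `F`. -/
def lieSpan (F : Set (Coord → Coord)) : Submodule ℝ (Coord → Coord) :=
  Submodule.span ℝ {Y | IsIteratedBracket F Y}

/-- `Lie_z(F)`: the tangent vectors at `z` that are values of fields in `Lie(F)`. -/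
def lieAt (F : Set (Coord → Coord)) (z : Coord) : Set Coord :=
  {v | ∃ Y ∈ lieSpan F, Y z = v}

/-- `F` is bracket-generating: `Lie_z(F)` is the whole tangent space at every point. -/
def IsBracketGenerating (F : Set (Coord → Coord)) : Prop :=
  ∀ z : Coord, lieAt F z = Set.univ

/-! ### The double pendulum on a cart -/

/-- `Δ(θ) = r₁ r₂ (m₁ + m₂ sin² (θ₁ - θ₂))`. -/
noncomputable def Delta (m₁ m₂ r₁ r₂ : ℝ) (z : Coord) : ℝ :=
  r₁ * r₂ * (m₁ + m₂ * Real.sin (z 0 - z 1) ^ 2)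

/-- The drift `f`. -/
noncomputable def drift (m₁ m₂ r₁ r₂ g : ℝ) (z : Coord) : Coord :=
  (1 / Delta m₁ m₂ r₁ r₂ z) •
    ![z 2 * Delta m₁ m₂ r₁ r₂ z,
      z 3 * Delta m₁ m₂ r₁ r₂ z,
      -g * r₂ * (m₂ * Real.sin (z 1) * Real.cos (z 0 - z 1) - (m₁ + m₂) * Real.sin (z 0)),
      -g * r₁ * (m₁ + m₂) * (Real.cos (z 0 - z 1) * Real.sin (z 0) - Real.sin (z 1))] +
  (Real.sin (z 0 - z 1) / Delta m₁ m₂ r₁ r₂ z) •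
    ![0,
      0,
      -m₂ * r₂ * (r₁ * Real.cos (z 0 - z 1) * z 2 ^ 2 + r₂ * z 3 ^ 2),
      r₁ * (r₁ * (m₁ + m₂) * z 2 ^ 2 + r₂ * m₂ * Real.cos (z 0 - z 1) * z 3 ^ 2)]

/-- The control field `h` in `z' = f(z) + h(z) u(t)`. -/
noncomputable def controlField (m₁ m₂ r₁ r₂ : ℝ) (z : Coord) : Coord :=
  (m₂ / Delta m₁ m₂ r₁ r₂ z) •
    ![0,
      0,
      r₂ * (r₁ * m₂ * Real.cos (z 0 - z 1) - r₂ * m₁),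
      r₁ * (r₂ * m₁ * Real.cos (z 0 - z 1) - r₁ * (m₁ + m₂))]

/-- `X₁ = Δ f`. -/
noncomputable def X₁ (m₁ m₂ r₁ r₂ g : ℝ) (z : Coord) : Coord :=
  Delta m₁ m₂ r₁ r₂ z • drift m₁ m₂ r₁ r₂ g z

/-- `X₂ = Δ h`. -/
noncomputable def X₂ (m₁ m₂ r₁ r₂ : ℝ) (z : Coord) : Coord :=
  Delta m₁ m₂ r₁ r₂ z • controlField m₁ m₂ r₁ r₂ z

/-- `X₃ = [X₁, X₂]`. -/
noncomputable def X₃ (m₁ m₂ r₁ r₂ g : ℝ) : Coord → Coord :=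
  VectorField.lieBracket ℝ (X₁ m₁ m₂ r₁ r₂ g) (X₂ m₁ m₂ r₁ r₂)

/-- `X₄ = [X₂, X₃]`. -/
noncomputable def X₄ (m₁ m₂ r₁ r₂ g : ℝ) : Coord → Coord :=
  VectorField.lieBracket ℝ (X₂ m₁ m₂ r₁ r₂) (X₃ m₁ m₂ r₁ r₂ g)

/-- The family `F = {X₁, X₂, X₃, X₄}`. -/
noncomputable def family (m₁ m₂ r₁ r₂ g : ℝ) : Set (Coord → Coord) :=
  {X₁ m₁ m₂ r₁ r₂ g, X₂ m₁ m₂ r₁ r₂, X₃ m₁ m₂ r₁ r₂ g, X₄ m₁ m₂ r₁ r₂ g}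

/-! ### The fields of the family live on `V` -/

theorem lieBracket_add_period {X Y : Coord → Coord} {v : Coord} (hX : ∀ z, X (z + v) = X z)
    (hY : ∀ z, Y (z + v) = Y z) (z : Coord) :
    VectorField.lieBracket ℝ X Y (z + v) = VectorField.lieBracket ℝ X Y z := by
  have h1 : fderiv ℝ X (z + v) = fderiv ℝ X z := by
    rw [← fderiv_comp_add_right]; simp only [hX]
  have h2 : fderiv ℝ Y (z + v) = fderiv ℝ Y z := by
    rw [← fderiv_comp_add_right]; simp only [hY]
  simp only [VectorField.lieBracket, h1, h2, hX, hY]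

/-- The fields of the family take equal values at any two lifts of the same point of `V`. -/
theorem eq_of_toState_eq {m₁ m₂ r₁ r₂ g : ℝ} {X : Coord → Coord} (hX : X ∈ family m₁ m₂ r₁ r₂ g)
    {z w : Coord} (h : toState z = toState w) : X z = X w := by
  simp only [toState, Prod.mk.injEq] at h
  obtain ⟨h0, h1, h2, h3⟩ := h
  have s0 : ((z - w) 0 : Real.Angle) = 0 := by simp [h0]
  have s1 : ((z - w) 1 : Real.Angle) = 0 := by simp [h1]
  obtain ⟨v, hv⟩ : ∃ v, v = z - w := ⟨_, rfl⟩
  rw [← hv] at s0 s1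
  have hz : z = w + v := by simp [hv]
  have v2 : v 2 = 0 := by simp [hv, h2]
  have v3 : v 3 = 0 := by simp [hv, h3]
  have sin_eq : ∀ a b : ℝ, (a : Real.Angle) = b → Real.sin a = Real.sin b := fun a b hab => by
    rw [← Real.Angle.sin_coe, hab, Real.Angle.sin_coe]
  have cos_eq : ∀ a b : ℝ, (a : Real.Angle) = b → Real.cos a = Real.cos b := fun a b hab => by
    rw [← Real.Angle.cos_coe, hab, Real.Angle.cos_coe]
  have e0 : ∀ u : Coord, Real.sin (u 0 + v 0) = Real.sin (u 0) :=
    fun u => sin_eq _ _ (by simp [s0])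
  have e1 : ∀ u : Coord, Real.sin (u 1 + v 1) = Real.sin (u 1) :=
    fun u => sin_eq _ _ (by simp [s1])
  have e2 : ∀ u : Coord, Real.sin (u 0 + v 0 - (u 1 + v 1)) = Real.sin (u 0 - u 1) :=
    fun u => sin_eq _ _ (by simp [s0, s1])
  have e3 : ∀ u : Coord, Real.cos (u 0 + v 0 - (u 1 + v 1)) = Real.cos (u 0 - u 1) :=
    fun u => cos_eq _ _ (by simp [s0, s1])
  have p1 : ∀ u, X₁ m₁ m₂ r₁ r₂ g (u + v) = X₁ m₁ m₂ r₁ r₂ g u := fun u => by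
    simp only [X₁, drift, Delta, Pi.add_apply, e0, e1, e2, e3, v2, v3, add_zero]
  have p2 : ∀ u, X₂ m₁ m₂ r₁ r₂ (u + v) = X₂ m₁ m₂ r₁ r₂ u := fun u => by
    simp only [X₂, controlField, Delta, Pi.add_apply, e2, e3]
  have p3 : ∀ u, X₃ m₁ m₂ r₁ r₂ g (u + v) = X₃ m₁ m₂ r₁ r₂ g u := lieBracket_add_period p1 p2
  have p4 : ∀ u, X₄ m₁ m₂ r₁ r₂ g (u + v) = X₄ m₁ m₂ r₁ r₂ g u := lieBracket_add_period p2 p3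
  rw [hz]
  rcases hX with rfl | rfl | rfl | rfl
  exacts [p1 w, p2 w, p3 w, p4 w]

end Pendulum

/-!
The family is controllable: every point of `V` is attainable from every other one, so that attainable
sets and orbits both coincide with `V`. This is shown by steering explicitly.

Besides `θ₁`, the coordinates are the relative angle `δ = θ₁ - θ₂`, the total angular momentum `L`
and the relative velocity `D = ω₁ - ω₂` (`Params.pt`). The fields `X₂` and `X₄` keep the angles and
move `(L, D)` along straight lines whose directions depend on `δ` only. Where
`sin δ cos δ (skew) ≤ 0`, with the rate `skew` of `D` along `X₂`, an affine function of `cos δ`, they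
combine to an arbitrarily large change of `D` at constant `L` (`Params.go_launch`). `X₁` is, up to
the time change by `Δ`, the motion of the double pendulum without control. It conserves the energy
and changes `L` at a bounded rate, the moment of gravity. Hence, if `D` is large and dominates a
suitable multiple of `L`, the pendulum makes full relative turns in a short time, and `D` keeps its
order of magnitude (`Params.exists_rotation`).

*Approach.* Every point can be led to a relative angle where `D` can be launched
(`Params.exists_launchable`): after a push along `X₂` that makes `|L|` or `|D|` large, the motion
along `X₁` either reaches `cos δ = 0`, or passes through a position with aligned rods, near which
the sign condition holds on one side, because `sin δ cos δ (skew)` is odd about it. For an acute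
relative angle this is a comparison with the harmonic oscillator, the restoring force being the
centrifugal one. A launch and a fast rotation then lead to any given relative angle at arbitrarily
high speed (`Params.exists_go_fast`).

*Adjustment.* There is a relative angle at which a fast rotation can be turned into any prescribed
`(L, D)` with a fixed change of `θ₁` (`Params.exists_adjustable`). In general one chooses `δ` with
`sin δ cos δ (skew) < 0`, where the pushes along `X₂` and `X₄` fill a cone whose interior contains
the direction opposite to the rotation. For the exceptional parameters with `skew = 0`, the field `X₃` rotates the `(L, D)`-plane,
and a half turn between two pushes suffices.

*Shift.* During one fast relative turn, `θ₁` changes by the holonomy of the turn plus an amount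
driven by `L`. As `L` is free within bounds proportional to the speed, the total change ranges over
an interval whose length does not depend on the speed (`Params.exists_shift`). Finitely many turns,
with an adjustment after each, produce every value of `θ₁` (`Params.exists_go_of_fast`).

*Departure.* The time reversal `(θ, ω) ↦ (θ, -ω)` turns `X₁`, `X₂` and `X₄` into their opposites, so
the approach, read backwards, leads from the chosen relative angle to an arbitrary end point.
-/

namespace Pendulum

open Real Set

lemma hasDerivAt_of_eq {f f₀ : ℝ → ℝ} {d d₀ x : ℝ} (h : HasDerivAt f₀ d₀ x)
    (hf : ∀ t, f t = f₀ t) (hd : d = d₀) : HasDerivAt f d x := by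
  rw [funext hf, hd]
  exact h

/-! ### Physical parameters and the coefficients built from them -/

/-- The masses, lengths and gravity constant of a double pendulum. -/
structure Params where
  m₁ : ℝ
  m₂ : ℝ
  r₁ : ℝ
  r₂ : ℝ
  g : ℝ
  m₁_pos : 0 < m₁
  m₂_pos : 0 < m₂
  r₁_pos : 0 < r₁
  r₂_pos : 0 < r₂
  g_pos : 0 < g

namespace Params

variable (P : Params)

/-- The coupling constant `m₂ r₁ r₂` of the mass matrix. -/
noncomputable def k : ℝ := P.m₂ * P.r₁ * P.r₂

/-- The upper left entry of the mass matrix. -/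
noncomputable def M₁ : ℝ := (P.m₁ + P.m₂) * P.r₁ ^ 2

/-- The lower right entry of the mass matrix; its off-diagonal entries are `k cos (θ₁ - θ₂)`. -/
noncomputable def M₂ : ℝ := P.m₂ * P.r₂ ^ 2

/-- The total moment of inertia, as a function of `c = cos (θ₁ - θ₂)`. -/
noncomputable def inertia (c : ℝ) : ℝ := P.M₁ + P.M₂ + 2 * P.k * c

/-- `Δ` as a function of `c = cos (θ₁ - θ₂)`. -/
noncomputable def vol (c : ℝ) : ℝ := P.r₁ * P.r₂ * (P.m₁ + P.m₂ * (1 - c ^ 2))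

/-- The `ω₁`-component of `X₂`. -/
noncomputable def push₁ (c : ℝ) : ℝ := P.m₂ * P.r₂ * (P.r₁ * P.m₂ * c - P.r₂ * P.m₁)

/-- The `ω₂`-component of `X₂`. -/
noncomputable def push₂ (c : ℝ) : ℝ :=
  P.m₂ * P.r₁ * (P.r₂ * P.m₁ * c - P.r₁ * (P.m₁ + P.m₂))

/-- The rate of `ω₁ - ω₂` along `X₂`; it is an affine function of `c = cos (θ₁ - θ₂)`. -/
noncomputable def skew (c : ℝ) : ℝ := P.push₁ c - P.push₂ c

/-- The quadratic polynomial in `c = cos (θ₁ - θ₂)` that governs the linear dependence of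
`X₂` and `X₄`: they are parallel exactly where `sin (θ₁ - θ₂)` or this polynomial vanishes. -/
noncomputable def twist (c : ℝ) : ℝ :=
  2 * P.m₁ * P.k * (P.m₁ + P.m₂) -
    2 * P.m₂ * (P.m₁ ^ 2 * P.r₂ ^ 2 + P.m₂ * (P.m₁ + P.m₂) * P.r₁ ^ 2) * c +
    2 * P.m₁ * P.m₂ * P.k * c ^ 2

/-- The fields of the family `F` for the parameters `P`. -/
noncomputable abbrev F₁ : Coord → Coord := X₁ P.m₁ P.m₂ P.r₁ P.r₂ P.g
/-- The field `X₂` for the parameters `P`. -/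
noncomputable abbrev F₂ : Coord → Coord := X₂ P.m₁ P.m₂ P.r₁ P.r₂
/-- The field `X₃` for the parameters `P`. -/
noncomputable abbrev F₃ : Coord → Coord := X₃ P.m₁ P.m₂ P.r₁ P.r₂ P.g
/-- The field `X₄` for the parameters `P`. -/
noncomputable abbrev F₄ : Coord → Coord := X₄ P.m₁ P.m₂ P.r₁ P.r₂ P.g

lemma k_pos : 0 < P.k := mul_pos (mul_pos P.m₂_pos P.r₁_pos) P.r₂_pos

lemma M₁_pos : 0 < P.M₁ := mul_pos (add_pos P.m₁_pos P.m₂_pos) (pow_pos P.r₁_pos 2)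

lemma M₂_pos : 0 < P.M₂ := mul_pos P.m₂_pos (pow_pos P.r₂_pos 2)

/-- A positive lower bound of the moment of inertia. -/
noncomputable def inertiaMin : ℝ := P.m₁ * P.r₁ ^ 2 + P.m₂ * (P.r₁ - P.r₂) ^ 2

/-- An upper bound of the moment of inertia. -/
noncomputable def inertiaMax : ℝ := P.M₁ + P.M₂ + 2 * P.k

/-- A positive lower bound of `Δ`. -/
noncomputable def volMin : ℝ := P.r₁ * P.r₂ * P.m₁

/-- An upper bound of `Δ`. -/
noncomputable def volMax : ℝ := P.r₁ * P.r₂ * (P.m₁ + P.m₂)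

lemma inertiaMin_pos : 0 < P.inertiaMin := by
  have := P.m₁_pos; have := P.r₁_pos; have := P.m₂_pos
  unfold inertiaMin; positivity

lemma volMin_pos : 0 < P.volMin := by
  have := P.m₁_pos; have := P.r₁_pos; have := P.r₂_pos
  unfold volMin; positivity

lemma inertiaMin_le {c : ℝ} (hc : -1 ≤ c) : P.inertiaMin ≤ P.inertia c := by
  have := mul_nonneg P.k_pos.le (by linarith : 0 ≤ 1 + c)
  unfold inertiaMin inertia M₁ M₂
  unfold k at *
  nlinarith

lemma inertia_le {c : ℝ} (hc : c ≤ 1) : P.inertia c ≤ P.inertiaMax := by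
  have := mul_nonneg P.k_pos.le (by linarith : 0 ≤ 1 - c)
  unfold inertiaMax inertia
  nlinarith

lemma volMin_le {c : ℝ} (h₁ : -1 ≤ c) (h₂ : c ≤ 1) : P.volMin ≤ P.vol c := by
  have hm := P.m₂_pos
  have hr := mul_pos P.r₁_pos P.r₂_pos
  unfold volMin vol
  have : 0 ≤ P.m₂ * (1 - c ^ 2) := mul_nonneg hm.le (by nlinarith)
  exact mul_le_mul_of_nonneg_left (by linarith) hr.le

lemma vol_le (c : ℝ) : P.vol c ≤ P.volMax := by
  have hm := P.m₂_pos
  have hr := mul_pos P.r₁_pos P.r₂_pos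
  unfold volMax vol
  have : P.m₂ * (1 - c ^ 2) ≤ P.m₂ := by nlinarith [sq_nonneg c]
  exact mul_le_mul_of_nonneg_left (by linarith) hr.le

lemma inertia_cos_pos (d : ℝ) : 0 < P.inertia (cos d) :=
  P.inertiaMin_pos.trans_le (P.inertiaMin_le (neg_one_le_cos d))

lemma vol_cos_pos (d : ℝ) : 0 < P.vol (cos d) :=
  P.volMin_pos.trans_le (P.volMin_le (neg_one_le_cos d) (cos_le_one d))

lemma inertiaMax_pos : 0 < P.inertiaMax :=
  P.inertiaMin_pos.trans_le ((P.inertiaMin_le neg_one_lt_zero.le).trans (P.inertia_le zero_le_one))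

lemma volMax_pos : 0 < P.volMax :=
  P.volMin_pos.trans_le ((P.volMin_le neg_one_lt_zero.le zero_le_one).trans (P.vol_le 0))

/-- Determinant of the mass matrix. -/
lemma det_mass (c : ℝ) : P.M₁ * P.M₂ - (P.k * c) ^ 2 = P.k * P.vol c := by
  unfold M₁ M₂ k vol; ring

lemma twist_pos_of_nonpos {c : ℝ} (hc : c ≤ 0) : 0 < P.twist c := by
  have := P.m₁_pos; have := P.m₂_pos; have := P.k_pos; have := P.r₁_pos; have := P.r₂_pos
  have h : 0 ≤ 2 * P.m₂ * (P.m₁ ^ 2 * P.r₂ ^ 2 + P.m₂ * (P.m₁ + P.m₂) * P.r₁ ^ 2) * (-c) :=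
    mul_nonneg (by positivity) (by linarith)
  have h' : 0 < 2 * P.m₁ * P.k * (P.m₁ + P.m₂) := by positivity
  have h'' : 0 ≤ 2 * P.m₁ * P.m₂ * P.k * c ^ 2 := by positivity
  unfold twist
  linarith

/-! ### The fields of the family in coordinates -/

/-- The `ω₁`-component of `X₁`. -/
noncomputable def acc₁ (z : Coord) : ℝ :=
  -P.g * P.r₂ * (P.m₂ * sin (z 1) * cos (z 0 - z 1) - (P.m₁ + P.m₂) * sin (z 0)) -
    P.m₂ * P.r₂ * sin (z 0 - z 1) *
      (P.r₁ * cos (z 0 - z 1) * z 2 ^ 2 + P.r₂ * z 3 ^ 2)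

/-- The `ω₂`-component of `X₁`. -/
noncomputable def acc₂ (z : Coord) : ℝ :=
  -P.g * P.r₁ * (P.m₁ + P.m₂) * (cos (z 0 - z 1) * sin (z 0) - sin (z 1)) +
    P.r₁ * sin (z 0 - z 1) *
      (P.r₁ * (P.m₁ + P.m₂) * z 2 ^ 2 + P.r₂ * P.m₂ * cos (z 0 - z 1) * z 3 ^ 2)

lemma Delta_eq (z : Coord) : Delta P.m₁ P.m₂ P.r₁ P.r₂ z = P.vol (cos (z 0 - z 1)) := by
  unfold Delta vol
  rw [sin_sq]

lemma F₁_apply (z : Coord) :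
    P.F₁ z = ![P.vol (cos (z 0 - z 1)) * z 2, P.vol (cos (z 0 - z 1)) * z 3,
      P.acc₁ z, P.acc₂ z] := by
  have h := (P.vol_cos_pos (z 0 - z 1)).ne'
  unfold F₁ X₁ drift
  rw [P.Delta_eq]
  ext i
  fin_cases i
  · simp [h, mul_comm]
  · simp [h, mul_comm]
  all_goals
    simp [acc₁, acc₂]
    field_simp
  ring

lemma F₂_apply (z : Coord) :
    P.F₂ z = ![0, 0, P.push₁ (cos (z 0 - z 1)), P.push₂ (cos (z 0 - z 1))] := by
  have h := (P.vol_cos_pos (z 0 - z 1)).ne'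
  unfold F₂ X₂ controlField
  rw [P.Delta_eq]
  ext i
  fin_cases i <;> simp [push₁, push₂] <;> field_simp

lemma contDiff_F₁ : ContDiff ℝ 2 P.F₁ := by
  have : P.F₁ = fun z => ![P.vol (cos (z 0 - z 1)) * z 2, P.vol (cos (z 0 - z 1)) * z 3,
      P.acc₁ z, P.acc₂ z] := funext P.F₁_apply
  rw [this]
  refine contDiff_pi.2 fun i => ?_
  fin_cases i <;> simp [acc₁, acc₂, vol] <;> fun_prop

lemma contDiff_F₂ : ContDiff ℝ 2 P.F₂ := by
  have : P.F₂ = fun z => ![0, 0, P.push₁ (cos (z 0 - z 1)), P.push₂ (cos (z 0 - z 1))] :=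
    funext P.F₂_apply
  rw [this]
  refine contDiff_pi.2 fun i => ?_
  fin_cases i <;> simp [push₁, push₂] <;> fun_prop

end Params

/-- A directional derivative is computed along the straight line, component by component. -/
lemma fderiv_apply_eq_of_hasDerivAt {V : Coord → Coord} {x w d : Coord}
    (hV : DifferentiableAt ℝ V x)
    (h : ∀ i, HasDerivAt (fun t : ℝ => V (x + t • w) i) (d i) 0) :
    fderiv ℝ V x w = d := by
  have h1 : HasDerivAt (fun t : ℝ => V (x + t • w)) (fderiv ℝ V x w) 0 := by
    have hl : HasDerivAt (fun t : ℝ => x + t • w) w 0 := by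
      simpa using ((hasDerivAt_id (0 : ℝ)).smul_const w).const_add x
    have hf : HasFDerivAt V (fderiv ℝ V x) (x + (0 : ℝ) • w) := by
      simpa using hV.hasFDerivAt
    exact hf.comp_hasDerivAt (0 : ℝ) hl
  exact h1.unique (hasDerivAt_pi.2 h)

namespace Params

variable (P : Params)

/-- The derivative of `X₂`, which is a function of `cos (θ₁ - θ₂)`, in a direction `w`. -/
lemma fderiv_F₂ (z w : Coord) :
    fderiv ℝ P.F₂ z w = (-sin (z 0 - z 1) * (w 0 - w 1)) •
      ![0, 0, P.m₂ * P.k, P.m₁ * P.k] := by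
  apply fderiv_apply_eq_of_hasDerivAt (P.contDiff_F₂.differentiable (by norm_num) z)
  have hc : HasDerivAt (fun t : ℝ => cos ((z + t • w) 0 - (z + t • w) 1))
      (-sin (z 0 - z 1) * (w 0 - w 1)) 0 := by
    have h : HasDerivAt (fun t : ℝ => (z + t • w) 0 - (z + t • w) 1) (w 0 - w 1) 0 := by
      have h0 := ((hasDerivAt_id (0 : ℝ)).mul_const (w 0)).const_add (z 0)
      have h1 := ((hasDerivAt_id (0 : ℝ)).mul_const (w 1)).const_add (z 1)
      exact hasDerivAt_of_eq (h0.sub h1) (fun t => by simp) (by simp)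
    exact hasDerivAt_of_eq h.cos (fun t => rfl) (by simp)
  intro i
  simp only [F₂_apply]
  fin_cases i
  · simpa using hasDerivAt_const (0 : ℝ) (0 : ℝ)
  · simpa using hasDerivAt_const (0 : ℝ) (0 : ℝ)
  · have := ((hc.const_mul (P.r₁ * P.m₂)).sub_const (P.r₂ * P.m₁)).const_mul (P.m₂ * P.r₂)
    simp only [Fin.reduceFinMk, Matrix.cons_val, Pi.smul_apply, smul_eq_mul]
    exact hasDerivAt_of_eq this (fun t => rfl) (by simp only [k]; ring)
  · have := ((hc.const_mul (P.r₂ * P.m₁)).sub_const (P.r₁ * (P.m₁ + P.m₂))).const_mul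
      (P.m₂ * P.r₁)
    simp only [Fin.reduceFinMk, Matrix.cons_val, Pi.smul_apply, smul_eq_mul]
    exact hasDerivAt_of_eq this (fun t => rfl) (by simp only [k]; ring)

/-- The derivative of `X₁` in the direction of an angular acceleration. -/
lemma fderiv_F₁_vertical (z : Coord) (a b : ℝ) :
    fderiv ℝ P.F₁ z ![0, 0, a, b] =
      ![P.vol (cos (z 0 - z 1)) * a, P.vol (cos (z 0 - z 1)) * b,
        -2 * P.m₂ * P.r₂ * sin (z 0 - z 1) *
          (P.r₁ * cos (z 0 - z 1) * z 2 * a + P.r₂ * z 3 * b),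
        2 * P.r₁ * sin (z 0 - z 1) *
          (P.r₁ * (P.m₁ + P.m₂) * z 2 * a + P.r₂ * P.m₂ * cos (z 0 - z 1) * z 3 * b)] := by
  apply fderiv_apply_eq_of_hasDerivAt (P.contDiff_F₁.differentiable (by norm_num) z)
  have h2 : HasDerivAt (fun t : ℝ => z 2 + t * a) a 0 := by
    simpa using ((hasDerivAt_id (0 : ℝ)).mul_const a).const_add (z 2)
  have h3 : HasDerivAt (fun t : ℝ => z 3 + t * b) b 0 := by
    simpa using ((hasDerivAt_id (0 : ℝ)).mul_const b).const_add (z 3)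
  intro i
  simp only [F₁_apply]
  fin_cases i
  · simpa using h2.const_mul (P.vol (cos (z 0 - z 1)))
  · simpa using h3.const_mul (P.vol (cos (z 0 - z 1)))
  · simp [acc₁]
    have := (((h2.pow 2).const_mul (P.r₁ * cos (z 0 - z 1))).add
      ((h3.pow 2).const_mul P.r₂)).const_mul (P.m₂ * P.r₂ * sin (z 0 - z 1))
    exact hasDerivAt_of_eq (this.neg.const_add (-(P.g * P.r₂ *
      (P.m₂ * sin (z 1) * cos (z 0 - z 1) - (P.m₁ + P.m₂) * sin (z 0)))))
      (fun t => by simp; ring) (by simp; ring)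
  · simp [acc₂]
    have := (((h2.pow 2).const_mul (P.r₁ * (P.m₁ + P.m₂))).add
      ((h3.pow 2).const_mul (P.r₂ * P.m₂ * cos (z 0 - z 1)))).const_mul
        (P.r₁ * sin (z 0 - z 1))
    exact hasDerivAt_of_eq this
      (fun t => by simp only [Pi.add_apply, Pi.pow_apply]) (by norm_num; ring)

lemma F₃_apply (z : Coord) :
    P.F₃ z =
      ![-P.vol (cos (z 0 - z 1)) * P.push₁ (cos (z 0 - z 1)),
        -P.vol (cos (z 0 - z 1)) * P.push₂ (cos (z 0 - z 1)),
        sin (z 0 - z 1) * (-P.vol (cos (z 0 - z 1)) * (z 2 - z 3) * (P.m₂ * P.k) +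
          2 * P.m₂ * P.r₂ * (P.r₁ * cos (z 0 - z 1) * z 2 * P.push₁ (cos (z 0 - z 1)) +
            P.r₂ * z 3 * P.push₂ (cos (z 0 - z 1)))),
        sin (z 0 - z 1) * (-P.vol (cos (z 0 - z 1)) * (z 2 - z 3) * (P.m₁ * P.k) -
          2 * P.r₁ * (P.r₁ * (P.m₁ + P.m₂) * z 2 * P.push₁ (cos (z 0 - z 1)) +
            P.r₂ * P.m₂ * cos (z 0 - z 1) * z 3 * P.push₂ (cos (z 0 - z 1))))] := by
  have : P.F₃ z = fderiv ℝ P.F₂ z (P.F₁ z) - fderiv ℝ P.F₁ z (P.F₂ z) := rfl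
  rw [this, fderiv_F₂, F₂_apply, fderiv_F₁_vertical, F₁_apply]
  ext i
  fin_cases i <;> simp <;> ring

lemma differentiable_F₃ : Differentiable ℝ P.F₃ := by
  rw [funext P.F₃_apply, differentiable_pi]
  intro i
  fin_cases i <;> simp [push₁, push₂, vol] <;> fun_prop

/-- The derivative of `X₃`, which is affine in the angular velocities, in the direction of an
angular acceleration. -/
lemma fderiv_F₃_vertical (z : Coord) (a b : ℝ) :
    fderiv ℝ P.F₃ z ![0, 0, a, b] =
      ![0, 0,
        sin (z 0 - z 1) * (-P.vol (cos (z 0 - z 1)) * (a - b) * (P.m₂ * P.k) +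
          2 * P.m₂ * P.r₂ * (P.r₁ * cos (z 0 - z 1) * a * P.push₁ (cos (z 0 - z 1)) +
            P.r₂ * b * P.push₂ (cos (z 0 - z 1)))),
        sin (z 0 - z 1) * (-P.vol (cos (z 0 - z 1)) * (a - b) * (P.m₁ * P.k) -
          2 * P.r₁ * (P.r₁ * (P.m₁ + P.m₂) * a * P.push₁ (cos (z 0 - z 1)) +
            P.r₂ * P.m₂ * cos (z 0 - z 1) * b * P.push₂ (cos (z 0 - z 1))))] := by
  apply fderiv_apply_eq_of_hasDerivAt (P.differentiable_F₃ z)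
  intro i
  have key : ∀ u v : ℝ, HasDerivAt (fun t : ℝ => u + t * v) v 0 := fun u v => by
    simpa using ((hasDerivAt_id (0 : ℝ)).mul_const v).const_add u
  simp only [F₃_apply]
  fin_cases i
  · simpa using hasDerivAt_const (0 : ℝ) _
  · simpa using hasDerivAt_const (0 : ℝ) _
  · exact hasDerivAt_of_eq (key (P.F₃ z 2) (sin (z 0 - z 1) * (-P.vol (cos (z 0 - z 1)) *
      (a - b) * (P.m₂ * P.k) + 2 * P.m₂ * P.r₂ * (P.r₁ * cos (z 0 - z 1) * a *
        P.push₁ (cos (z 0 - z 1)) + P.r₂ * b * P.push₂ (cos (z 0 - z 1))))))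
      (fun t => by simp [F₃_apply]; ring) (by simp)
  · exact hasDerivAt_of_eq (key (P.F₃ z 3) (sin (z 0 - z 1) * (-P.vol (cos (z 0 - z 1)) *
      (a - b) * (P.m₁ * P.k) - 2 * P.r₁ * (P.r₁ * (P.m₁ + P.m₂) * a *
        P.push₁ (cos (z 0 - z 1)) + P.r₂ * P.m₂ * cos (z 0 - z 1) * b *
          P.push₂ (cos (z 0 - z 1))))))
      (fun t => by simp [F₃_apply]; ring) (by simp)

/-- `X₄` changes only the angular velocities, at a rate determined by `θ₁ - θ₂`. -/
lemma F₄_apply (z : Coord) :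
    P.F₄ z = (2 * sin (z 0 - z 1)) •
      ![0, 0,
        -P.vol (cos (z 0 - z 1)) * P.skew (cos (z 0 - z 1)) * (P.m₂ * P.k) +
          P.m₂ * P.r₂ * (P.r₁ * cos (z 0 - z 1) * P.push₁ (cos (z 0 - z 1)) ^ 2 +
            P.r₂ * P.push₂ (cos (z 0 - z 1)) ^ 2),
        -P.vol (cos (z 0 - z 1)) * P.skew (cos (z 0 - z 1)) * (P.m₁ * P.k) -
          P.r₁ * (P.r₁ * (P.m₁ + P.m₂) * P.push₁ (cos (z 0 - z 1)) ^ 2 +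
            P.r₂ * P.m₂ * cos (z 0 - z 1) * P.push₂ (cos (z 0 - z 1)) ^ 2)] := by
  have : P.F₄ z = fderiv ℝ P.F₃ z (P.F₂ z) - fderiv ℝ P.F₂ z (P.F₃ z) := rfl
  rw [this, fderiv_F₂, F₂_apply, fderiv_F₃_vertical, F₃_apply]
  ext i
  fin_cases i <;> simp [skew] <;> ring

end Params

/-! ### Attainability between coordinate points -/

/-- `w` represents a point attainable from the point represented by `z`. -/
def Go (F : Set (Coord → Coord)) (z w : Coord) : Prop := toState w ∈ attainableSet F (toState z)

variable {F F' : Set (Coord → Coord)} {z w v : Coord}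

lemma Go.trans (h₁ : Go F z w) (h₂ : Go F w v) : Go F z v := Relation.ReflTransGen.trans h₁ h₂

lemma Go.mono (hF : F ⊆ F') (h : Go F z w) : Go F' z w := by
  refine Relation.ReflTransGen.mono ?_ _ _ h
  rintro a b ⟨X, hX, t, ht, hf⟩
  exact ⟨X, hF hX, t, ht, hf⟩

lemma Go.of_toState_eq (h : toState z = toState w) : Go F z w := by
  unfold Go
  rw [← h]
  exact Relation.ReflTransGen.refl

lemma Go.refl (z : Coord) : Go F z z := .of_toState_eq rfl

lemma Go.of_curve {X : Coord → Coord} (hX : X ∈ F) {γ : ℝ → Coord}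
    (hγ : IsIntegralCurve γ fun _ => X) {t : ℝ} (ht : 0 ≤ t) : Go F (γ 0) (γ t) :=
  Relation.ReflTransGen.single ⟨X, hX, t, ht, γ, hγ, rfl, rfl⟩

/-- Time reversal `(θ, ω) ↦ (θ, -ω)`. -/
def reverse (z : Coord) : Coord := ![z 0, z 1, -z 2, -z 3]

@[simp] lemma reverse_reverse (z : Coord) : reverse (reverse z) = z := by
  ext i; fin_cases i <;> simp [reverse]

/-- If time reversal turns every field of the family into its opposite, it turns attainability
around. -/
lemma Go.reverse (hF : ∀ X ∈ F, ∀ z, X (reverse z) = -Pendulum.reverse (X z)) (h : Go F z w) :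
    Go F (Pendulum.reverse w) (Pendulum.reverse z) := by
  have key : ∀ a b : State, Relation.ReflTransGen
      (fun a b => ∃ X ∈ F, ∃ t : ℝ, 0 ≤ t ∧ FlowsTo X t a b) a b →
      Relation.ReflTransGen (fun a b => ∃ X ∈ F, ∃ t : ℝ, 0 ≤ t ∧ FlowsTo X t a b)
        (b.1, b.2.1, -b.2.2.1, -b.2.2.2) (a.1, a.2.1, -a.2.2.1, -a.2.2.2) := by
    intro a b hab
    induction hab with
    | refl => exact Relation.ReflTransGen.refl
    | tail _ hbc ih =>
      obtain ⟨X, hX, t, ht, γ, hγ, h0, h1⟩ := hbc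
      refine Relation.ReflTransGen.head ⟨X, hX, t, ht, fun s => Pendulum.reverse (γ (t - s)), ?_,
        ?_, ?_⟩ ih
      · intro s
        have h2 : HasDerivAt (fun s => γ (t - s)) (-X (γ (t - s))) s := by
          have h := (hγ (t - s)).scomp s ((hasDerivAt_id s).const_sub t)
          rwa [neg_one_smul] at h
        have h3 := hasDerivAt_pi.1 h2
        beta_reduce
        rw [hF X hX]
        refine hasDerivAt_pi.2 fun i => ?_
        fin_cases i
        · simpa [Pendulum.reverse] using h3 0
        · simpa [Pendulum.reverse] using h3 1
        · exact hasDerivAt_of_eq (h3 2).neg (fun _ => rfl) (by simp [Pendulum.reverse])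
        · exact hasDerivAt_of_eq (h3 3).neg (fun _ => rfl) (by simp [Pendulum.reverse])
      · simp [toState, Pendulum.reverse, ← h1]
      · simp [toState, Pendulum.reverse, ← h0]
  exact key _ _ h

namespace Params

variable (P : Params)

/-! ### Angular momentum and relative velocity as coordinates -/

/-- The total angular momentum. -/
noncomputable def angMom (z : Coord) : ℝ :=
  (P.M₁ + P.k * cos (z 0 - z 1)) * z 2 + (P.k * cos (z 0 - z 1) + P.M₂) * z 3

/-- The point with `θ₁ = θ`, `θ₁ - θ₂ = d`, angular momentum `L` and `ω₁ - ω₂ = D`. -/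
noncomputable def pt (θ d L D : ℝ) : Coord :=
  ![θ, θ - d, (L + (P.k * cos d + P.M₂) * D) / P.inertia (cos d),
    (L - (P.M₁ + P.k * cos d) * D) / P.inertia (cos d)]

@[simp] lemma pt_zero (θ d L D : ℝ) : P.pt θ d L D 0 = θ := rfl
@[simp] lemma pt_one (θ d L D : ℝ) : P.pt θ d L D 1 = θ - d := rfl
lemma pt_two (θ d L D : ℝ) :
    P.pt θ d L D 2 = (L + (P.k * cos d + P.M₂) * D) / P.inertia (cos d) := rfl
lemma pt_three (θ d L D : ℝ) :
    P.pt θ d L D 3 = (L - (P.M₁ + P.k * cos d) * D) / P.inertia (cos d) := rfl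

@[simp] lemma pt_gap (θ d L D : ℝ) : P.pt θ d L D 2 - P.pt θ d L D 3 = D := by
  have h := (P.inertia_cos_pos d).ne'
  rw [pt_two, pt_three]
  field_simp
  unfold inertia
  ring

@[simp] lemma angMom_pt (θ d L D : ℝ) : P.angMom (P.pt θ d L D) = L := by
  have h := (P.inertia_cos_pos d).ne'
  simp only [angMom, pt_two, pt_three, pt_zero, pt_one, sub_sub_cancel]
  field_simp
  unfold inertia
  ring

lemma eq_pt (z : Coord) : z = P.pt (z 0) (z 0 - z 1) (P.angMom z) (z 2 - z 3) := by
  have h := (P.inertia_cos_pos (z 0 - z 1)).ne'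
  ext i
  fin_cases i
  · simp
  · simp
  · simp only [Fin.reduceFinMk, pt_two]
    rw [eq_div_iff h]
    unfold angMom inertia
    ring
  · simp only [Fin.reduceFinMk, pt_three]
    rw [eq_div_iff h]
    unfold angMom inertia
    ring

lemma reverse_pt (θ d L D : ℝ) : reverse (P.pt θ d L D) = P.pt θ d (-L) (-D) := by
  ext i
  fin_cases i <;> simp [reverse, pt_two, pt_three] <;> ring

lemma toState_pt_add_two_pi (θ d L D : ℝ) (m n : ℤ) :
    toState (P.pt (θ + m * (2 * π)) (d + n * (2 * π)) L D) = toState (P.pt θ d L D) := by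
  have hc : cos (d + n * (2 * π)) = cos d := cos_add_int_mul_two_pi d n
  have h0 : ((θ + m * (2 * π) : ℝ) : Real.Angle) = θ := by
    rw [Real.Angle.angle_eq_iff_two_pi_dvd_sub]
    exact ⟨m, by ring⟩
  have h1 : ((θ + m * (2 * π) - (d + n * (2 * π)) : ℝ) : Real.Angle) = (θ - d : ℝ) := by
    rw [Real.Angle.angle_eq_iff_two_pi_dvd_sub]
    exact ⟨m - n, by push_cast; ring⟩
  simp only [toState, pt_zero, pt_one, pt_two, pt_three, hc, h0, h1]

/-! ### The flows of `X₂` and `X₄` -/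

lemma isIntegralCurve_vertical {X : Coord → Coord} {θ d a b : ℝ} (L D : ℝ)
    (hX : ∀ L D, X (P.pt θ d L D) = ![0, 0, (a + (P.k * cos d + P.M₂) * b) / P.inertia (cos d),
      (a - (P.M₁ + P.k * cos d) * b) / P.inertia (cos d)]) :
    IsIntegralCurve (fun t => P.pt θ d (L + t * a) (D + t * b)) fun _ => X := by
  intro t
  beta_reduce
  rw [hX]
  have ha : HasDerivAt (fun t => L + t * a) a t := by
    simpa using ((hasDerivAt_id t).mul_const a).const_add L
  have hb : HasDerivAt (fun t => D + t * b) b t := by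
    simpa using ((hasDerivAt_id t).mul_const b).const_add D
  refine hasDerivAt_pi.2 fun i => ?_
  fin_cases i
  · simpa using hasDerivAt_const t θ
  · simpa using hasDerivAt_const t (θ - d)
  · exact (ha.add (hb.const_mul (P.k * cos d + P.M₂))).div_const _
  · exact (ha.sub (hb.const_mul (P.M₁ + P.k * cos d))).div_const _

lemma vertical_congr {a b a' b' : ℝ} (ha : a = a') (hb : b = b') :
    (![0, 0, a, b] : Coord) = ![0, 0, a', b'] := by rw [ha, hb]

lemma go_F₂ (hF : P.F₂ ∈ F) (θ d L D : ℝ) {t : ℝ} (ht : 0 ≤ t) :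
    Go F (P.pt θ d L D) (P.pt θ d (L - t * (P.k * (P.m₁ + P.m₂) * P.vol (cos d)))
      (D + t * P.skew (cos d))) := by
  have h := P.isIntegralCurve_vertical (X := P.F₂) (θ := θ) (d := d)
    (a := -(P.k * (P.m₁ + P.m₂) * P.vol (cos d))) (b := P.skew (cos d)) L D (fun L D => by
      have h := (P.inertia_cos_pos d).ne'
      rw [F₂_apply]
      simp only [pt_zero, pt_one, sub_sub_cancel]
      apply vertical_congr <;> rw [eq_div_iff h] <;>
        simp only [inertia, skew, push₁, push₂, vol, M₁, M₂, k] <;> ring)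
  simpa [sub_eq_add_neg] using Go.of_curve hF h ht

lemma go_F₄ (hF : P.F₄ ∈ F) (θ d L D : ℝ) {t : ℝ} (ht : 0 ≤ t) :
    Go F (P.pt θ d L D)
      (P.pt θ d (L - t * (4 * P.k ^ 2 * (P.m₁ + P.m₂) * P.vol (cos d) *
          (sin d * cos d * P.skew (cos d))))
        (D + t * (P.k * sin d * (4 * cos d * P.skew (cos d) ^ 2 +
          P.inertia (cos d) * P.twist (cos d))))) := by
  have h := P.isIntegralCurve_vertical (X := P.F₄) (θ := θ) (d := d)
    (a := -(4 * P.k ^ 2 * (P.m₁ + P.m₂) * P.vol (cos d) * (sin d * cos d * P.skew (cos d))))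
    (b := P.k * sin d * (4 * cos d * P.skew (cos d) ^ 2 +
      P.inertia (cos d) * P.twist (cos d))) L D (fun L D => by
      have h := (P.inertia_cos_pos d).ne'
      rw [F₄_apply]
      simp only [pt_zero, pt_one, sub_sub_cancel, Matrix.smul_cons, smul_eq_mul, mul_zero,
        Matrix.smul_empty]
      apply vertical_congr <;> rw [eq_div_iff h] <;>
        simp only [inertia, skew, twist, push₁, push₂, vol, M₁, M₂, k] <;> ring)
  simpa [sub_eq_add_neg] using Go.of_curve hF h ht

/-- Where `sin δ cos δ (skew) ≤ 0`, the flows of `X₄` and `X₂` combine to a change of the relative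
velocity, in the direction of `sin δ (twist)`, that keeps the angular momentum. -/
lemma go_launch (h₂ : P.F₂ ∈ F) (h₄ : P.F₄ ∈ F) {d : ℝ}
    (hd : sin d * cos d * P.skew (cos d) ≤ 0) (θ L D : ℝ) {x : ℝ} (hx : 0 ≤ x) :
    Go F (P.pt θ d L D)
      (P.pt θ d L (D + x * (P.k * P.inertia (cos d) * (sin d * P.twist (cos d))))) := by
  have hy : 0 ≤ 4 * P.k * x * -(sin d * cos d * P.skew (cos d)) :=
    mul_nonneg (mul_nonneg (by have := P.k_pos; positivity) hx) (by linarith)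
  have h := (P.go_F₄ h₄ θ d L D hx).trans (P.go_F₂ h₂ θ d _ _ hy)
  convert h using 2 <;> ring

end Params

namespace Params

variable (P : Params)

/-! ### Evolution along the orbits of `X₁` -/

/-- The potential energy. -/
noncomputable def pot (z : Coord) : ℝ :=
  P.g * ((P.m₁ + P.m₂) * P.r₁ * cos (z 0) + P.m₂ * P.r₂ * cos (z 1))

/-- The total energy, a first integral of `X₁`. -/
noncomputable def energy (z : Coord) : ℝ :=
  (P.M₁ * z 2 ^ 2 + P.M₂ * z 3 ^ 2) / 2 + P.k * cos (z 0 - z 1) * z 2 * z 3 + P.pot z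

/-- The moment of the gravity forces. -/
noncomputable def torque (z : Coord) : ℝ :=
  P.g * ((P.m₁ + P.m₂) * P.r₁ * sin (z 0) + P.m₂ * P.r₂ * sin (z 1))

/-- The contribution of gravity to the relative acceleration, up to a factor. -/
noncomputable def tilt (z : Coord) : ℝ :=
  P.g * (P.m₂ * P.r₂ * sin (z 1) * (P.M₁ + P.k * cos (z 0 - z 1)) -
    (P.m₁ + P.m₂) * P.r₁ * sin (z 0) * (P.k * cos (z 0 - z 1) + P.M₂))

lemma two_inertia_mul_kinetic (z : Coord) :
    2 * P.inertia (cos (z 0 - z 1)) * (P.energy z - P.pot z) =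
      P.angMom z ^ 2 + P.k * P.vol (cos (z 0 - z 1)) * (z 2 - z 3) ^ 2 := by
  rw [← det_mass]
  unfold energy angMom inertia
  ring

variable {P} in
/-- The law of the relative acceleration, with the terms in the angular velocities expressed through
the angular momentum and the relative velocity. -/
lemma relAcc_mul_inertia (z : Coord) :
    (P.acc₁ z - P.acc₂ z) * P.inertia (cos (z 0 - z 1)) +
      (z 2 - z 3) ^ 2 * (P.k * sin (z 0 - z 1) *
        (cos (z 0 - z 1) * P.inertia (cos (z 0 - z 1)) + P.vol (cos (z 0 - z 1)))) =
    -(sin (z 0 - z 1) * P.angMom z ^ 2 + P.tilt z * P.inertia (cos (z 0 - z 1)) / P.k) := by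
  have hk := P.k_pos.ne'
  have h1 : P.tilt z / P.k = P.g * (sin (z 1) * (P.m₁ + P.m₂) * (P.r₁ + P.r₂ * cos (z 0 - z 1))
      - (P.m₁ + P.m₂) * P.r₁ * sin (z 0) * (cos (z 0 - z 1))
      - (P.m₁ + P.m₂) * sin (z 0) * P.r₂)
      - P.g * sin (z 1) * P.m₁ * P.r₂ * cos (z 0 - z 1) := by
    rw [div_eq_iff hk]
    unfold tilt M₁ M₂ k
    ring
  rw [mul_div_right_comm, h1]
  unfold acc₁ acc₂ inertia angMom vol M₁ M₂ k
  ring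

/-- The factor `√(Δ / I)` that turns `ω₁ - ω₂` into the velocity of the relative motion in a coordinate
in which this motion has constant mass. -/
noncomputable def scale (c : ℝ) : ℝ :=
  √(P.vol c / P.inertia c)

variable {P} in
lemma scale_pos (d : ℝ) : 0 < P.scale (cos d) :=
  sqrt_pos.2 (div_pos (P.vol_cos_pos d) (P.inertia_cos_pos d))

variable {P} in
lemma scale_sq (d : ℝ) : P.scale (cos d) ^ 2 = P.vol (cos d) / P.inertia (cos d) :=
  sq_sqrt (div_pos (P.vol_cos_pos d) (P.inertia_cos_pos d)).le

section Orbit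

variable {P} {γ : ℝ → Coord} {t : ℝ}

lemma hasDerivAt_energy {a : ℝ} (h : HasDerivAt γ (a • P.F₁ (γ t)) t) :
    HasDerivAt (fun t => P.energy (γ t)) 0 t := by
  have h := hasDerivAt_pi.1 h
  simp only [F₁_apply, Pi.smul_apply, smul_eq_mul] at h
  have h0 := h 0
  have h1 := h 1
  have h2 := h 2
  have h3 := h 3
  simp only [Matrix.cons_val] at h0 h1 h2 h3
  have H := ((((h2.pow 2).const_mul P.M₁).add ((h3.pow 2).const_mul P.M₂)).div_const 2).add
    (((((h0.sub h1).cos).const_mul P.k).mul h2).mul h3) |>.add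
    (((h0.cos.const_mul ((P.m₁ + P.m₂) * P.r₁)).add
      (h1.cos.const_mul (P.m₂ * P.r₂))).const_mul P.g)
  refine hasDerivAt_of_eq H (fun t => ?_) ?_
  · simp [energy, pot]
  · simp only [Pi.sub_apply, acc₁, acc₂, vol, M₁, M₂, k]
    norm_num
    ring

variable (h : HasDerivAt γ (P.F₁ (γ t)) t)
include h

lemma hasDerivAt_gap :
    HasDerivAt (fun t => γ t 0 - γ t 1)
      (P.vol (cos (γ t 0 - γ t 1)) * (γ t 2 - γ t 3)) t := by
  have h := hasDerivAt_pi.1 h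
  simp only [F₁_apply] at h
  exact hasDerivAt_of_eq ((h 0).sub (h 1)) (fun t => rfl) (by simp; ring)

lemma hasDerivAt_angMom :
    HasDerivAt (fun t => P.angMom (γ t)) (P.vol (cos (γ t 0 - γ t 1)) * P.torque (γ t)) t := by
  have h := hasDerivAt_pi.1 h
  simp only [F₁_apply] at h
  have h0 := h 0
  have h1 := h 1
  have h2 := h 2
  have h3 := h 3
  simp only [Matrix.cons_val] at h0 h1 h2 h3
  have hc := ((h0.sub h1).cos).const_mul P.k
  refine hasDerivAt_of_eq (((hc.const_add P.M₁).mul h2).add ((hc.add_const P.M₂).mul h3))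
    (fun t => rfl) ?_
  simp only [Pi.sub_apply, acc₁, acc₂, torque, vol, M₁, M₂, k]
  ring

lemma hasDerivAt_relVel :
    HasDerivAt (fun t => γ t 2 - γ t 3) (P.acc₁ (γ t) - P.acc₂ (γ t)) t := by
  have h := hasDerivAt_pi.1 h
  simp only [F₁_apply] at h
  exact hasDerivAt_of_eq ((h 2).sub (h 3)) (fun t => rfl) (by simp)

/-- In the rescaled relative velocity `(ω₁ - ω₂) √(Δ / I)`, the relative acceleration depends on
the angular momentum and on gravity alone. -/
lemma hasDerivAt_scaledVel :
    HasDerivAt (fun t => (γ t 2 - γ t 3) * P.scale (cos (γ t 0 - γ t 1)))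
      (-(P.scale (cos (γ t 0 - γ t 1)) / P.inertia (cos (γ t 0 - γ t 1)) *
        (sin (γ t 0 - γ t 1) * P.angMom (γ t) ^ 2 +
          P.tilt (γ t) * P.inertia (cos (γ t 0 - γ t 1)) / P.k))) t := by
  have hI := (P.inertia_cos_pos (γ t 0 - γ t 1)).ne'
  have hv := (P.vol_cos_pos (γ t 0 - γ t 1)).ne'
  have hc := (hasDerivAt_gap h).cos
  have hvol : HasDerivAt (fun t => P.vol (cos (γ t 0 - γ t 1)))
      (2 * P.k * cos (γ t 0 - γ t 1) * (sin (γ t 0 - γ t 1) *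
        (P.vol (cos (γ t 0 - γ t 1)) * (γ t 2 - γ t 3)))) t := by
    refine hasDerivAt_of_eq ((((hc.pow 2).const_sub 1).const_mul P.m₂).const_add P.m₁
      |>.const_mul (P.r₁ * P.r₂)) (fun t => rfl) ?_
    simp only [k]; norm_num; ring
  have hin : HasDerivAt (fun t => P.inertia (cos (γ t 0 - γ t 1)))
      (-(2 * P.k * (sin (γ t 0 - γ t 1) *
        (P.vol (cos (γ t 0 - γ t 1)) * (γ t 2 - γ t 3))))) t := by
    refine hasDerivAt_of_eq ((hc.const_mul (2 * P.k)).const_add (P.M₁ + P.M₂)) (fun t => rfl) ?_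
    ring
  have hs := (hvol.div hin hI).sqrt (div_ne_zero hv hI)
  refine hasDerivAt_of_eq ((hasDerivAt_relVel h).mul hs) (fun t => rfl) ?_
  have hsc : √(((fun t => P.vol (cos (γ t 0 - γ t 1))) /
      fun t => P.inertia (cos (γ t 0 - γ t 1))) t) = P.scale (cos (γ t 0 - γ t 1)) := rfl
  have hpos := (scale_pos (P := P) (γ t 0 - γ t 1)).ne'
  have hsq := scale_sq (P := P) (γ t 0 - γ t 1)
  rw [hsc, ← mul_neg, ← relAcc_mul_inertia]
  generalize P.scale (cos (γ t 0 - γ t 1)) = S at *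
  have hvS : P.vol (cos (γ t 0 - γ t 1)) = S ^ 2 * P.inertia (cos (γ t 0 - γ t 1)) := by
    rw [hsq]; field_simp
  generalize P.vol (cos (γ t 0 - γ t 1)) = V at *
  subst hvS
  field_simp
  ring

end Orbit

/-- The coordinate on the circle of the relative angle `θ₁ - θ₂` in which the relative motion has
constant mass. -/
noncomputable def arc (d : ℝ) : ℝ :=
  ∫ u in (0 : ℝ)..d, (P.inertia (cos u) * P.scale (cos u))⁻¹

lemma continuous_inertia_cos : Continuous fun u : ℝ => P.inertia (cos u) := by
  unfold inertia; fun_prop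

lemma continuous_vol_cos : Continuous fun u : ℝ => P.vol (cos u) := by
  unfold vol; fun_prop

lemma continuous_scale_cos : Continuous fun u : ℝ => P.scale (cos u) :=
  (P.continuous_vol_cos.div P.continuous_inertia_cos
    fun u => (P.inertia_cos_pos u).ne').sqrt

lemma hasDerivAt_arc (d : ℝ) :
    HasDerivAt P.arc (P.inertia (cos d) * P.scale (cos d))⁻¹ d := by
  have hc : Continuous fun u : ℝ => (P.inertia (cos u) * P.scale (cos u))⁻¹ :=
    (P.continuous_inertia_cos.mul P.continuous_scale_cos).inv₀ fun u =>
      (mul_pos (P.inertia_cos_pos u) (scale_pos u)).ne'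
  exact intervalIntegral.integral_hasDerivAt_right (hc.intervalIntegrable _ _)
    (hc.stronglyMeasurableAtFilter _ _) hc.continuousAt

@[simp] lemma arc_zero : P.arc 0 = 0 := intervalIntegral.integral_same

lemma strictMono_arc : StrictMono P.arc := by
  apply strictMono_of_deriv_pos
  intro d
  rw [(P.hasDerivAt_arc d).deriv]
  exact inv_pos.2 (mul_pos (P.inertia_cos_pos d) (scale_pos d))

/-- The angle by which `θ₁` turns while the relative angle runs from `0` to `d` with vanishing
angular momentum. -/
noncomputable def holonomy (d : ℝ) : ℝ :=
  ∫ u in (0 : ℝ)..d, (P.k * cos u + P.M₂) / P.inertia (cos u)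

lemma hasDerivAt_holonomy (d : ℝ) :
    HasDerivAt P.holonomy ((P.k * cos d + P.M₂) / P.inertia (cos d)) d := by
  have hc : Continuous fun u : ℝ => (P.k * cos u + P.M₂) / P.inertia (cos u) :=
    Continuous.div (by fun_prop) P.continuous_inertia_cos fun u => (P.inertia_cos_pos u).ne'
  exact intervalIntegral.integral_hasDerivAt_right (hc.intervalIntegrable _ _)
    (hc.stronglyMeasurableAtFilter _ _) hc.continuousAt

variable {P} {γ : ℝ → Coord} {t : ℝ}

lemma hasDerivAt_arc_gap (h : HasDerivAt γ (P.F₁ (γ t)) t) :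
    HasDerivAt (fun t => P.arc (γ t 0 - γ t 1))
      ((γ t 2 - γ t 3) * P.scale (cos (γ t 0 - γ t 1))) t := by
  refine hasDerivAt_of_eq ((P.hasDerivAt_arc _).comp t (hasDerivAt_gap h)) (fun t => rfl) ?_
  have hI := (P.inertia_cos_pos (γ t 0 - γ t 1)).ne'
  have hpos := (scale_pos (P := P) (γ t 0 - γ t 1)).ne'
  have hsq := scale_sq (P := P) (γ t 0 - γ t 1)
  generalize P.scale (cos (γ t 0 - γ t 1)) = S at *
  rw [eq_div_iff hI] at hsq
  rw [← hsq]
  field_simp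

/-- Up to the holonomy, `θ₁` is driven by the angular momentum alone. -/
lemma hasDerivAt_angle_sub_holonomy (h : HasDerivAt γ (P.F₁ (γ t)) t) :
    HasDerivAt (fun t => γ t 0 - P.holonomy (γ t 0 - γ t 1))
      (P.vol (cos (γ t 0 - γ t 1)) * P.angMom (γ t) / P.inertia (cos (γ t 0 - γ t 1))) t := by
  have h0 := hasDerivAt_pi.1 h 0
  simp only [F₁_apply, Matrix.cons_val] at h0
  refine hasDerivAt_of_eq
    (h0.sub ((P.hasDerivAt_holonomy _).comp t (hasDerivAt_gap h))) (fun t => rfl) ?_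
  have hI := (P.inertia_cos_pos (γ t 0 - γ t 1)).ne'
  field_simp
  unfold angMom inertia
  ring

end Params

namespace Params

variable (P : Params)

/-! ### The flow of `X₁` -/

/-- A bound of the potential energy. -/
noncomputable def potMax : ℝ := P.g * ((P.m₁ + P.m₂) * P.r₁ + P.m₂ * P.r₂)

lemma potMax_pos : 0 < P.potMax := by
  have := P.m₁_pos; have := P.m₂_pos; have := P.r₁_pos; have := P.r₂_pos; have := P.g_pos
  unfold potMax; positivity

lemma abs_grav_le {a b : ℝ} (ha : |a| ≤ 1) (hb : |b| ≤ 1) :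
    |P.g * ((P.m₁ + P.m₂) * P.r₁ * a + P.m₂ * P.r₂ * b)| ≤ P.potMax := by
  have hg := P.g_pos
  have h1 : 0 < (P.m₁ + P.m₂) * P.r₁ := mul_pos (add_pos P.m₁_pos P.m₂_pos) P.r₁_pos
  have h2 : 0 < P.m₂ * P.r₂ := mul_pos P.m₂_pos P.r₂_pos
  rw [abs_mul, abs_of_pos hg]
  refine mul_le_mul_of_nonneg_left ((abs_add_le _ _).trans ?_) hg.le
  rw [abs_mul, abs_mul (P.m₂ * P.r₂), abs_of_pos h1, abs_of_pos h2]
  nlinarith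

lemma abs_pot_le (z : Coord) : |P.pot z| ≤ P.potMax :=
  P.abs_grav_le (abs_cos_le_one _) (abs_cos_le_one _)

lemma abs_torque_le (z : Coord) : |P.torque z| ≤ P.potMax :=
  P.abs_grav_le (abs_sin_le_one _) (abs_sin_le_one _)

/-- A bound of the angular velocities at energy `E`. -/
noncomputable def speed (E : ℝ) : ℝ :=
  2 * (P.M₁ + P.M₂) * (E + P.potMax) / (P.k * P.volMin) + 1

lemma speed_mono {E E' : ℝ} (h : E ≤ E') : P.speed E ≤ P.speed E' := by
  have h1 := add_pos P.M₁_pos P.M₂_pos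
  have h2 := mul_pos P.k_pos P.volMin_pos
  unfold speed
  gcongr

lemma sq_add_sq_le (z : Coord) : z 2 ^ 2 + z 3 ^ 2 + 1 ≤ P.speed (P.energy z) := by
  have h1 := add_pos P.M₁_pos P.M₂_pos
  have h2 := mul_pos P.k_pos P.volMin_pos
  have h3 : P.volMin ≤ P.vol (cos (z 0 - z 1)) := P.volMin_le (neg_one_le_cos _) (cos_le_one _)
  have h4 := (abs_le.1 (P.abs_pot_le z)).2
  have h5 := P.det_mass (cos (z 0 - z 1))
  unfold speed
  rw [add_le_add_iff_right, le_div_iff₀ h2]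
  have h6 : (P.M₁ + P.M₂) * (2 * (P.energy z - P.pot z)) -
      P.k * P.vol (cos (z 0 - z 1)) * (z 2 ^ 2 + z 3 ^ 2) =
      (P.M₁ * z 2 + P.k * cos (z 0 - z 1) * z 3) ^ 2 +
        (P.k * cos (z 0 - z 1) * z 2 + P.M₂ * z 3) ^ 2 := by
    rw [← h5]; unfold energy; ring
  have h7 : (z 2 ^ 2 + z 3 ^ 2) * (P.k * P.volMin) ≤
      P.k * P.vol (cos (z 0 - z 1)) * (z 2 ^ 2 + z 3 ^ 2) := by
    rw [mul_comm]
    gcongr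
    exact P.k_pos.le
  have h8 : (P.M₁ + P.M₂) * (-P.pot z) ≤ (P.M₁ + P.M₂) * P.potMax :=
    mul_le_mul_of_nonneg_left (by linarith [(abs_le.1 (P.abs_pot_le z)).1]) h1.le
  nlinarith [sq_nonneg (P.M₁ * z 2 + P.k * cos (z 0 - z 1) * z 3),
    sq_nonneg (P.k * cos (z 0 - z 1) * z 2 + P.M₂ * z 3)]

lemma one_le_speed (z : Coord) : 1 ≤ P.speed (P.energy z) := by
  nlinarith [P.sq_add_sq_le z, sq_nonneg (z 2), sq_nonneg (z 3)]

lemma abs_vel_le (z : Coord) :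
    |z 2| ≤ P.speed (P.energy z) ∧ |z 3| ≤ P.speed (P.energy z) := by
  have h := P.sq_add_sq_le z
  constructor <;> refine abs_le.2 ⟨?_, ?_⟩ <;>
    nlinarith [sq_nonneg (z 2), sq_nonneg (z 3), sq_nonneg (z 2 - 1), sq_nonneg (z 3 - 1),
      sq_nonneg (z 2 + 1), sq_nonneg (z 3 + 1)]

variable {P}

lemma abs_sub_le_of_hasDerivAt {f f' : ℝ → ℝ} {s : Set ℝ} (hs : Convex ℝ s) {C : ℝ}
    (hf : ∀ t ∈ s, HasDerivAt f (f' t) t) (hC : ∀ t ∈ s, |f' t| ≤ C) {x y : ℝ} (hx : x ∈ s)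
    (hy : y ∈ s) : |f y - f x| ≤ C * |y - x| :=
  hs.norm_image_sub_le_of_norm_hasDerivWithin_le (fun t ht => (hf t ht).hasDerivWithinAt) hC hx hy

lemma energy_eq_of_hasDerivAt {γ : ℝ → Coord} {a : ℝ → ℝ} {s : Set ℝ} (hs : Convex ℝ s)
    (hγ : ∀ t ∈ s, HasDerivAt γ (a t • P.F₁ (γ t)) t) {x y : ℝ} (hx : x ∈ s) (hy : y ∈ s) :
    P.energy (γ y) = P.energy (γ x) := by
  have := abs_sub_le_of_hasDerivAt hs (C := 0) (fun t ht => hasDerivAt_energy (hγ t ht))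
    (by simp) hx hy
  rw [zero_mul] at this
  exact sub_eq_zero.1 (abs_eq_zero.1 (le_antisymm this (abs_nonneg _)))

/-- Orbits of `X₁`, even with a slowed-down time, stay in a ball that depends only on the energy
and on the initial point. -/
lemma norm_le_of_hasDerivAt {γ : ℝ → Coord} {a : ℝ → ℝ} {s : Set ℝ} (hs : Convex ℝ s)
    (h0 : 0 ∈ s) (ha : ∀ t ∈ s, |a t| ≤ 1) {T : ℝ} (hT : ∀ t ∈ s, |t| ≤ T)
    (hγ : ∀ t ∈ s, HasDerivAt γ (a t • P.F₁ (γ t)) t) {r E : ℝ} (hr : ‖γ 0‖ ≤ r)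
    (hE : P.energy (γ 0) ≤ E) {t : ℝ} (ht : t ∈ s) :
    ‖γ t‖ ≤ r + P.volMax * P.speed E * T + P.speed E := by
  have hsp : ∀ t ∈ s, P.speed (P.energy (γ t)) ≤ P.speed E := fun t ht => by
    rw [energy_eq_of_hasDerivAt hs hγ h0 ht]; exact P.speed_mono hE
  have h1 : 1 ≤ P.speed E := (P.one_le_speed _).trans (hsp 0 h0)
  have hV := P.volMax_pos
  have hT0 : 0 ≤ T := (abs_nonneg _).trans (hT 0 h0)
  have hr0 : 0 ≤ r := (norm_nonneg _).trans hr
  have hp : 0 ≤ P.volMax * P.speed E * T := by positivity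
  have hvol : ∀ c ω : ℝ, |ω| ≤ P.speed E → ∀ x ∈ s,
      |a x * (P.vol (cos c) * ω)| ≤ P.volMax * P.speed E := fun c ω hω x hx => by
    have e1 : |P.vol (cos c) * ω| ≤ P.volMax * P.speed E := by
      rw [abs_mul, abs_of_pos (P.vol_cos_pos c)]
      exact mul_le_mul (P.vol_le _) hω (abs_nonneg _) hV.le
    rw [abs_mul]
    calc |a x| * |P.vol (cos c) * ω| ≤ 1 * |P.vol (cos c) * ω| := by
          gcongr; exact ha x hx
      _ ≤ _ := by rwa [one_mul]
  have hmove : ∀ t, t ∈ s → P.volMax * P.speed E * |t - 0| ≤ P.volMax * P.speed E * T :=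
    fun t ht => mul_le_mul_of_nonneg_left (by simpa using hT t ht) (by positivity)
  have hcomp : ∀ i, ‖γ 0 i‖ ≤ r := fun i => (norm_le_pi_norm _ i).trans hr
  refine (pi_norm_le_iff_of_nonneg (by positivity)).2 fun i => ?_
  have hd := fun x hx => hasDerivAt_pi.1 (hγ x hx)
  simp only [F₁_apply, Pi.smul_apply, smul_eq_mul] at hd
  rw [Real.norm_eq_abs]
  fin_cases i
  · have h := abs_sub_le_of_hasDerivAt hs (fun x hx => hd x hx 0) (fun x hx => hvol _ _
      ((P.abs_vel_le (γ x)).1.trans (hsp x hx)) x hx) h0 ht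
    have h' := abs_sub_abs_le_abs_sub (γ t 0) (γ 0 0)
    have := hcomp 0
    rw [Real.norm_eq_abs] at this
    have := hmove t ht
    simp only [Fin.zero_eta]
    linarith
  · have h := abs_sub_le_of_hasDerivAt hs (fun x hx => hd x hx 1) (fun x hx => hvol _ _
      ((P.abs_vel_le (γ x)).2.trans (hsp x hx)) x hx) h0 ht
    have h' := abs_sub_abs_le_abs_sub (γ t 1) (γ 0 1)
    have := hcomp 1
    rw [Real.norm_eq_abs] at this
    have := hmove t ht
    simp only [Fin.mk_one]
    linarith
  · have := (P.abs_vel_le (γ t)).1.trans (hsp t ht)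
    simp only [Fin.reduceFinMk]
    linarith
  · have := (P.abs_vel_le (γ t)).2.trans (hsp t ht)
    simp only [Fin.reduceFinMk]
    linarith

/-- Orbits of `X₁` exist on arbitrarily long time intervals: cut the field off outside a large
ball, which the conservation of energy keeps the orbit from leaving. -/
lemma exists_hasDerivAt_Ioo (z : Coord) {T : ℝ} (hT : 0 < T) :
    ∃ γ : ℝ → Coord, γ 0 = z ∧ ∀ t ∈ Ioo (-T) T, HasDerivAt γ (P.F₁ (γ t)) t := by
  set R := ‖z‖ + P.volMax * P.speed (P.energy z) * T + P.speed (P.energy z) with hR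
  have hR0 : 0 < R := by
    have := P.one_le_speed z
    have := P.volMax_pos
    positivity
  let f : ContDiffBump (0 : Coord) := ⟨R, R + 1, hR0, by linarith⟩
  have hYc : ContDiff ℝ 1 fun z => f z • P.F₁ z :=
    f.contDiff.smul (P.contDiff_F₁.of_le (by norm_num))
  have hYs : HasCompactSupport fun z => f z • P.F₁ z := f.hasCompactSupport.smul_right
  obtain ⟨K, hK⟩ := hYc.lipschitzWith_of_hasCompactSupport hYs one_ne_zero
  obtain ⟨M, hM⟩ := hYs.exists_bound_of_continuous hYc.continuous
  have hM0 : 0 ≤ M := (norm_nonneg _).trans (hM 0)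
  have hpl : IsPicardLindelof (fun _ z => f z • P.F₁ z)
      (⟨0, by constructor <;> linarith⟩ : Icc (-T) T) z (⟨M, hM0⟩ * ⟨T, hT.le⟩) 0 ⟨M, hM0⟩ K := by
    refine .of_time_independent (fun x _ => hM x) hK.lipschitzOnWith ?_
    simp only [sub_zero, zero_sub, neg_neg, max_self, NNReal.coe_zero]
    exact le_rfl
  obtain ⟨γ, h0, hγ⟩ := hpl.exists_eq_forall_mem_Icc_hasDerivWithinAt₀
  have h0 : γ 0 = z := h0
  have hγ' : ∀ t ∈ Ioo (-T) T, HasDerivAt γ (f (γ t) • P.F₁ (γ t)) t := fun t ht =>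
    (hγ t (Ioo_subset_Icc_self ht)).hasDerivAt (Icc_mem_nhds ht.1 ht.2)
  refine ⟨γ, h0, fun t ht => ?_⟩
  have hb := norm_le_of_hasDerivAt (convex_Ioo (-T) T) ⟨by linarith, hT⟩
    (a := fun t => f (γ t)) (fun t _ => by rw [abs_of_nonneg f.nonneg]; exact f.le_one)
    (fun t ht => (abs_lt.2 ht).le) hγ' (r := ‖z‖) (E := P.energy z) (by rw [h0])
    (by rw [h0]) ht
  have h1 : f (γ t) = 1 := f.one_of_mem_closedBall (by simpa using hb)
  simpa [h1] using hγ' t ht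

open scoped Manifold in
/-- The field `X₁` is complete. -/
lemma exists_isIntegralCurve (z : Coord) :
    ∃ γ : ℝ → Coord, IsIntegralCurve γ (fun _ => P.F₁) ∧ γ 0 = z := by
  have hv : ContMDiff 𝓘(ℝ, Coord) 𝓘(ℝ, Coord).tangent 1
      (fun x : Coord => (⟨x, P.F₁ x⟩ : TangentBundle 𝓘(ℝ, Coord) Coord)) :=
    contMDiff_vectorSpace_iff_contDiff.2 (P.contDiff_F₁.of_le (by norm_num))
  obtain ⟨γ, h0, hγ⟩ := (exists_isMIntegralCurve_iff_exists_isMIntegralCurveOn_Ioo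
    (I := 𝓘(ℝ, Coord)) (v := P.F₁) hv z).2 fun a => by
      obtain ⟨γ, h0, h⟩ := exists_hasDerivAt_Ioo (P := P) z (T := |a| + 1) (by positivity)
      refine ⟨γ, h0, fun t ht => ?_⟩
      have ha := le_abs_self a
      have := (h t ⟨by linarith [ht.1], by linarith [ht.2]⟩).hasFDerivAt.hasMFDerivAt
      exact this.hasMFDerivWithinAt
  refine ⟨γ, fun t => ?_, h0⟩
  have h : HasFDerivAt γ ((1 : ℝ →L[ℝ] ℝ).smulRight (P.F₁ (γ t))) t :=
    hasMFDerivAt_iff_hasFDerivAt.1 (hγ t)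
  simpa using h.hasDerivAt

variable (P) in
/-- The orbit of `X₁` that starts at `z`. -/
noncomputable def traj (z : Coord) : ℝ → Coord := (exists_isIntegralCurve (P := P) z).choose

lemma isIntegralCurve_traj (z : Coord) : IsIntegralCurve (P.traj z) fun _ => P.F₁ :=
  (exists_isIntegralCurve (P := P) z).choose_spec.1

lemma hasDerivAt_traj (z : Coord) (t : ℝ) : HasDerivAt (P.traj z) (P.F₁ (P.traj z t)) t :=
  isIntegralCurve_traj z t

@[simp] lemma traj_zero (z : Coord) : P.traj z 0 = z :=
  (exists_isIntegralCurve (P := P) z).choose_spec.2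

lemma continuous_energy : Continuous P.energy := by
  unfold energy pot; fun_prop

lemma continuous_traj_apply (z : Coord) : Continuous (P.traj z) :=
  (isIntegralCurve_traj z).continuous

/-- Orbits of `X₁` depend continuously on time and on the initial point. -/
lemma continuousOn_traj :
    ContinuousOn (fun p : Coord × ℝ => P.traj p.1 p.2) (univ ×ˢ Ici 0) := by
  rintro ⟨z₀, t₀⟩ ⟨-, ht₀⟩
  have ht₀ : 0 ≤ t₀ := ht₀
  obtain ⟨E, hE⟩ := (isCompact_closedBall z₀ (1 : ℝ)).exists_bound_of_continuousOn
    (continuous_energy (P := P)).continuousOn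
  set R := ‖z₀‖ + 1 + P.volMax * P.speed E * (t₀ + 1) + P.speed E
  have hbound : ∀ z ∈ Metric.closedBall z₀ (1 : ℝ), ∀ t ∈ Icc 0 (t₀ + 1),
      P.traj z t ∈ Metric.closedBall (0 : Coord) R := fun z hz t ht => by
    rw [mem_closedBall_zero_iff]
    refine norm_le_of_hasDerivAt (convex_Icc 0 (t₀ + 1)) ⟨le_rfl, by linarith⟩ (a := fun _ => 1)
      (by simp) (fun t ht => by rw [abs_of_nonneg ht.1]; exact ht.2)
      (fun t _ => by simpa using hasDerivAt_traj z t) ?_ ?_ ht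
    · rw [traj_zero]
      have h1 : dist z z₀ ≤ 1 := hz
      rw [dist_eq_norm] at h1
      linarith [norm_sub_norm_le z z₀]
    · rw [traj_zero]
      exact (le_abs_self _).trans (hE z hz)
  obtain ⟨K, hK⟩ := (P.contDiff_F₁.contDiffOn (s := Metric.closedBall (0 : Coord) R)
    ).exists_lipschitzOnWith (by norm_num) (convex_closedBall _ _) (isCompact_closedBall _ _)
  have hdist : ∀ z ∈ Metric.closedBall z₀ (1 : ℝ), ∀ t ∈ Icc 0 (t₀ + 1),
      dist (P.traj z t) (P.traj z₀ t) ≤ dist z z₀ * exp (K * (t₀ + 1)) := fun z hz t ht => by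
    have h := dist_le_of_trajectories_ODE_of_mem (v := fun _ => P.F₁)
      (s := fun _ => Metric.closedBall (0 : Coord) R) (a := 0) (b := t₀ + 1) (δ := dist z z₀)
      (fun _ _ => hK) (continuous_traj_apply z).continuousOn
      (fun t _ => (hasDerivAt_traj z t).hasDerivWithinAt)
      (fun t ht => hbound z hz t (Ico_subset_Icc_self ht))
      (continuous_traj_apply z₀).continuousOn
      (fun t _ => (hasDerivAt_traj z₀ t).hasDerivWithinAt)
      (fun t ht => hbound z₀ (Metric.mem_closedBall_self zero_le_one) t
        (Ico_subset_Icc_self ht)) (by simp) t ht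
    refine h.trans ?_
    gcongr
    linarith [ht.2]
  rw [ContinuousWithinAt, tendsto_iff_dist_tendsto_zero]
  have hlim : Filter.Tendsto (fun p : Coord × ℝ => dist p.1 z₀ * exp (K * (t₀ + 1)) +
      dist (P.traj z₀ p.2) (P.traj z₀ t₀)) (nhdsWithin (z₀, t₀) (univ ×ˢ Ici 0)) (nhds 0) := by
    have hc : Continuous fun p : Coord × ℝ => dist p.1 z₀ * exp (K * (t₀ + 1)) +
        dist (P.traj z₀ p.2) (P.traj z₀ t₀) := by
      have := continuous_traj_apply (P := P) z₀
      fun_prop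
    simpa using (hc.tendsto (z₀, t₀)).mono_left nhdsWithin_le_nhds
  refine squeeze_zero' (Filter.Eventually.of_forall fun _ => dist_nonneg) ?_ hlim
  have h1 : ∀ᶠ p : Coord × ℝ in nhds (z₀, t₀), p.1 ∈ Metric.closedBall z₀ (1 : ℝ) ∧ p.2 < t₀ + 1 :=
    (continuous_fst.continuousAt.eventually_mem (Metric.closedBall_mem_nhds _ one_pos)).and
      (continuous_snd.continuousAt.eventually_lt continuousAt_const (by simp))
  filter_upwards [mem_nhdsWithin_of_mem_nhds h1, self_mem_nhdsWithin] with p hp hp'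
  exact (dist_triangle _ (P.traj z₀ p.2) _).trans
    (add_le_add_left (hdist p.1 hp.1 p.2 ⟨hp'.2, hp.2.le⟩) _)

end Params

/-! ### Fast rotation -/

lemma mul_sub_le_of_hasDerivAt {f f' : ℝ → ℝ} {s : Set ℝ} (hs : Convex ℝ s) {C : ℝ}
    (hf : ∀ t ∈ s, HasDerivAt f (f' t) t) (hC : ∀ t ∈ s, C ≤ f' t) {x y : ℝ} (hx : x ∈ s)
    (hy : y ∈ s) (hxy : x ≤ y) : C * (y - x) ≤ f y - f x :=
  hs.mul_sub_le_image_sub_of_le_deriv (fun t ht => (hf t ht).continuousAt.continuousWithinAt)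
    (fun t ht => (hf t (interior_subset ht)).differentiableAt.differentiableWithinAt)
    (fun t ht => by rw [(hf t (interior_subset ht)).deriv]; exact hC t (interior_subset ht))
    x hx y hy hxy

/-- A continuous function that is positive at `0` stays positive if it cannot have a first zero. -/
lemma pos_of_no_first_zero {f : ℝ → ℝ} {T : ℝ} (hf : ContinuousOn f (Icc 0 T)) (h0 : 0 < f 0)
    (h : ∀ t ∈ Icc 0 T, (∀ s ∈ Icc 0 t, 0 ≤ f s) → f t ≠ 0) {t : ℝ} (ht : t ∈ Icc 0 T) :
    0 < f t := by
  by_contra! hft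
  have hsub : Icc 0 t ⊆ Icc 0 T := Icc_subset_Icc_right ht.2
  have hcomp : IsCompact (Icc 0 t ∩ f ⁻¹' Iic 0) :=
    isCompact_Icc.of_isClosed_subset
      ((hf.mono hsub).preimage_isClosed_of_isClosed isClosed_Icc isClosed_Iic) inter_subset_left
  obtain ⟨t₁, ⟨ht₁, hft₁⟩, hmin⟩ := hcomp.exists_isLeast ⟨t, ⟨ht.1, le_rfl⟩, hft⟩
  have hpos : ∀ s ∈ Icc 0 t, s < t₁ → 0 < f s := fun s hs hst => by
    by_contra! hfs
    exact absurd (hmin ⟨hs, hfs⟩) (not_le.2 hst)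
  have hsub₁ : Icc 0 t₁ ⊆ Icc 0 t := Icc_subset_Icc_right ht₁.2
  obtain ⟨s, hs, hfs⟩ := intermediate_value_Icc' ht₁.1 (hf.mono (hsub₁.trans hsub))
    (⟨hft₁, h0.le⟩ : (0 : ℝ) ∈ Icc (f t₁) (f 0))
  have hst : s = t₁ := le_antisymm hs.2 (hmin ⟨hsub₁ hs, hfs.le⟩)
  rw [hst] at hfs
  refine h t₁ (hsub ht₁) (fun s hs => ?_) hfs
  rcases hs.2.eq_or_lt with rfl | hlt
  · exact hfs.ge
  · exact (hpos s (hsub₁ hs) hlt).le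

namespace Params

variable {P : Params}

variable (P) in
/-- A bound of the rate of the angular momentum along `X₁`. -/
noncomputable def drag : ℝ := P.volMax * P.potMax

lemma drag_pos : 0 < P.drag := mul_pos P.volMax_pos P.potMax_pos

lemma abs_angMom_sub_le (z : Coord) {t : ℝ} (ht : 0 ≤ t) :
    |P.angMom (P.traj z t) - P.angMom z| ≤ P.drag * t := by
  have h := abs_sub_le_of_hasDerivAt (C := P.drag) convex_univ
    (fun t _ => hasDerivAt_angMom (hasDerivAt_traj (P := P) z t)) (fun t _ => by
      rw [abs_mul, abs_of_pos (P.vol_cos_pos _)]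
      exact mul_le_mul (P.vol_le _) (P.abs_torque_le _) (abs_nonneg _) P.volMax_pos.le)
    (mem_univ 0) (mem_univ t)
  simpa [abs_of_nonneg ht] using h

lemma energy_traj (z : Coord) (t : ℝ) : P.energy (P.traj z t) = P.energy z := by
  have h := energy_eq_of_hasDerivAt (P := P) (γ := P.traj z) (a := fun _ => 1) convex_univ
    (fun t _ => by simpa using hasDerivAt_traj z t) (mem_univ 0) (mem_univ t)
  simpa using h

/-- Conservation of energy, in terms of the angular momentum and of the relative velocity. -/
lemma relVel_sq_traj (z : Coord) (t : ℝ) :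
    P.k * P.vol (cos (P.traj z t 0 - P.traj z t 1)) * (P.traj z t 2 - P.traj z t 3) ^ 2 =
      P.inertia (cos (P.traj z t 0 - P.traj z t 1)) / P.inertia (cos (z 0 - z 1)) *
        (P.angMom z ^ 2 + P.k * P.vol (cos (z 0 - z 1)) * (z 2 - z 3) ^ 2) +
      2 * P.inertia (cos (P.traj z t 0 - P.traj z t 1)) * (P.pot z - P.pot (P.traj z t)) -
      P.angMom (P.traj z t) ^ 2 := by
  have h1 := P.two_inertia_mul_kinetic z
  have h2 := P.two_inertia_mul_kinetic (P.traj z t)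
  have hI := (P.inertia_cos_pos (z 0 - z 1)).ne'
  rw [energy_traj] at h2
  rw [← h1, eq_sub_iff_add_eq', ← h2]
  field_simp
  ring

lemma two_inertia_mul_pot_sub (z w : Coord) (d : ℝ) :
    |2 * P.inertia (cos d) * (P.pot z - P.pot w)| ≤ 4 * P.inertiaMax * P.potMax := by
  have h1 := P.inertia_cos_pos d
  have h2 := P.inertia_le (cos_le_one d)
  have h3 : |P.pot z - P.pot w| ≤ 2 * P.potMax := by
    have := abs_le.1 (P.abs_pot_le z)
    have := abs_le.1 (P.abs_pot_le w)
    exact abs_le.2 ⟨by linarith, by linarith⟩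
  rw [abs_mul, abs_of_pos (by linarith)]
  have := P.potMax_pos
  have := P.inertiaMax_pos
  calc 2 * P.inertia (cos d) * |P.pot z - P.pot w|
      ≤ 2 * P.inertiaMax * (2 * P.potMax) := by gcongr
    _ = _ := by ring

variable (P) in
/-- If the relative velocity dominates a multiple of the angular momentum and is large enough, it
keeps its sign and its order of magnitude during a unit of time, while the angular momentum remains
almost constant. -/
lemma exists_rotation_bounds : ∃ c C κ S₀ : ℝ, 0 < c ∧ 0 < C ∧ 0 < κ ∧ 0 < S₀ ∧
    ∀ (z : Coord) (η : ℝ), η ^ 2 = 1 → S₀ ≤ η * (z 2 - z 3) →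
      |P.angMom z| ≤ κ * (η * (z 2 - z 3)) → ∀ t ∈ Icc (0 : ℝ) 1,
        c * (η * (z 2 - z 3)) ≤ η * (P.traj z t 2 - P.traj z t 3) ∧
        η * (P.traj z t 2 - P.traj z t 3) ≤ C * (η * (z 2 - z 3)) ∧
        |P.angMom (P.traj z t) - P.angMom z| ≤ C := by
  have hk := P.k_pos
  have hv := P.volMin_pos
  have hV := P.volMax_pos
  have hi := P.inertiaMin_pos
  have hI := P.inertiaMax_pos
  have hB := drag_pos (P := P)
  have hp := P.potMax_pos
  set i := P.inertiaMin / P.inertiaMax with hidef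
  have hi0 : 0 < i := div_pos hi hI
  set A := 4 * P.inertiaMax * P.potMax with hA
  have hA0 : 0 < A := by positivity
  set U := i * (P.k * P.volMin) with hU
  have hU0 : 0 < U := by positivity
  set κ := √(U / 8) with hκ
  have hκ2 : κ ^ 2 = U / 8 := sq_sqrt (by positivity)
  have hκ0 : 0 < κ := sqrt_pos.2 (by positivity)
  set c := √(U / (2 * (P.k * P.volMax))) with hc
  have hc2 : c ^ 2 = U / (2 * (P.k * P.volMax)) := sq_sqrt (by positivity)
  have hc0 : 0 < c := sqrt_pos.2 (by positivity)
  set W := (i⁻¹ * (κ ^ 2 + P.k * P.volMax) + A) / (P.k * P.volMin) with hW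
  have hW0 : 0 < W := by positivity
  set S₀ := √(4 * (A + 2 * P.drag ^ 2) / U) + 1 with hS₀
  have hS1 : 1 ≤ S₀ := by have := sqrt_nonneg (4 * (A + 2 * P.drag ^ 2) / U); linarith
  refine ⟨c, √W + P.drag, κ, S₀, hc0, by positivity, hκ0, by linarith, ?_⟩
  intro z η hη hS hL
  set S := η * (z 2 - z 3) with hSdef
  have hSpos : 0 < S := by linarith
  have hS2 : S ^ 2 = (z 2 - z 3) ^ 2 := by rw [hSdef, mul_pow, hη, one_mul]
  have hbig : A + 2 * P.drag ^ 2 ≤ U / 4 * S ^ 2 := by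
    have h1 : √(4 * (A + 2 * P.drag ^ 2) / U) ≤ S := by linarith
    have h2 := (sqrt_le_left hSpos.le).1 h1
    rw [div_le_iff₀ hU0] at h2
    linarith
  have key : ∀ t ∈ Icc (0 : ℝ) 1, (c * S) ^ 2 ≤ (P.traj z t 2 - P.traj z t 3) ^ 2 ∧
      (P.traj z t 2 - P.traj z t 3) ^ 2 ≤ (√W * S) ^ 2 ∧
      |P.angMom (P.traj z t) - P.angMom z| ≤ P.drag := by
    intro t ht
    have hdr : |P.angMom (P.traj z t) - P.angMom z| ≤ P.drag :=
      (abs_angMom_sub_le z ht.1).trans (mul_le_of_le_one_right hB.le ht.2)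
    have hE := relVel_sq_traj (P := P) z t
    have hp := abs_le.1 (two_inertia_mul_pot_sub (P := P) z (P.traj z t)
      (P.traj z t 0 - P.traj z t 1))
    have hIt := P.inertiaMin_le (neg_one_le_cos (P.traj z t 0 - P.traj z t 1))
    have hIt' := P.inertia_le (cos_le_one (P.traj z t 0 - P.traj z t 1))
    have hI0 := P.inertiaMin_le (neg_one_le_cos (z 0 - z 1))
    have hI0' := P.inertia_le (cos_le_one (z 0 - z 1))
    have hvt := P.volMin_le (neg_one_le_cos (P.traj z t 0 - P.traj z t 1)) (cos_le_one _)
    have hvt' := P.vol_le (cos (P.traj z t 0 - P.traj z t 1))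
    have hv0 := P.volMin_le (neg_one_le_cos (z 0 - z 1)) (cos_le_one _)
    have hv0' := P.vol_le (cos (z 0 - z 1))
    have hLt : |P.angMom (P.traj z t)| ≤ κ * S + P.drag := by
      have := abs_sub_abs_le_abs_sub (P.angMom (P.traj z t)) (P.angMom z)
      linarith
    have hLt2 : P.angMom (P.traj z t) ^ 2 ≤ (κ * S + P.drag) ^ 2 := sq_le_sq.2
      (hLt.trans (le_abs_self _))
    have hL2 : P.angMom z ^ 2 ≤ (κ * S) ^ 2 := sq_le_sq.2 (hL.trans (le_abs_self _))
    have hr1 : i ≤ P.inertia (cos (P.traj z t 0 - P.traj z t 1)) / P.inertia (cos (z 0 - z 1)) :=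
      div_le_div₀ (by linarith) hIt (by linarith) hI0'
    have hr2 : P.inertia (cos (P.traj z t 0 - P.traj z t 1)) / P.inertia (cos (z 0 - z 1)) ≤
        i⁻¹ := by
      rw [hidef, inv_div]
      exact div_le_div₀ hI.le hIt' hi hI0
    generalize P.inertia (cos (P.traj z t 0 - P.traj z t 1)) / P.inertia (cos (z 0 - z 1)) = ρ at *
    generalize P.traj z t 2 - P.traj z t 3 = D at *
    rw [← hS2] at hE
    have hQ1 : P.k * P.volMin * S ^ 2 ≤
        P.angMom z ^ 2 + P.k * P.vol (cos (z 0 - z 1)) * S ^ 2 := by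
      have : P.k * P.volMin * S ^ 2 ≤ P.k * P.vol (cos (z 0 - z 1)) * S ^ 2 := by gcongr
      linarith [sq_nonneg (P.angMom z)]
    have hQ2 : P.angMom z ^ 2 + P.k * P.vol (cos (z 0 - z 1)) * S ^ 2 ≤
        (κ ^ 2 + P.k * P.volMax) * S ^ 2 := by
      have : P.k * P.vol (cos (z 0 - z 1)) * S ^ 2 ≤ P.k * P.volMax * S ^ 2 := by gcongr
      rw [mul_pow] at hL2
      linarith
    generalize P.angMom z ^ 2 + P.k * P.vol (cos (z 0 - z 1)) * S ^ 2 = Q at *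
    have hQ0 : 0 ≤ Q := le_trans (by positivity) hQ1
    refine ⟨?_, ?_, hdr⟩
    · have e1 : U * S ^ 2 ≤ ρ * Q := by
        calc U * S ^ 2 = i * (P.k * P.volMin * S ^ 2) := by rw [hU]; ring
          _ ≤ ρ * Q := mul_le_mul hr1 hQ1 (by positivity) (by linarith)
      have e2 : (κ * S + P.drag) ^ 2 ≤ U / 4 * S ^ 2 + 2 * P.drag ^ 2 := by
        have : U / 4 * S ^ 2 = 2 * (κ * S) ^ 2 := by rw [mul_pow κ S, hκ2]; ring
        rw [this]
        linarith [sq_nonneg (κ * S - P.drag), add_sq (κ * S) P.drag, sub_sq (κ * S) P.drag]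
      have e3 : U / 2 * S ^ 2 ≤ P.k * P.volMax * D ^ 2 := by
        have : P.k * P.vol (cos (P.traj z t 0 - P.traj z t 1)) * D ^ 2 ≤
          P.k * P.volMax * D ^ 2 := by gcongr
        linarith
      rw [mul_pow, hc2, div_mul_eq_mul_div, div_le_iff₀ (by positivity)]
      linarith
    · have e1 : ρ * Q ≤ i⁻¹ * ((κ ^ 2 + P.k * P.volMax) * S ^ 2) :=
        mul_le_mul hr2 hQ2 hQ0 (by positivity)
      have e2 : A ≤ A * S ^ 2 := by
        exact le_mul_of_one_le_right hA0.le (one_le_pow₀ (by linarith))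
      have e3 : P.k * P.volMin * D ^ 2 ≤
        P.k * P.vol (cos (P.traj z t 0 - P.traj z t 1)) * D ^ 2 := by gcongr
      rw [mul_pow, sq_sqrt hW0.le, hW, div_mul_eq_mul_div, le_div_iff₀ (by positivity)]
      linarith [sq_nonneg (P.angMom (P.traj z t))]
  have hpos : ∀ t ∈ Icc (0 : ℝ) 1, 0 < η * (P.traj z t 2 - P.traj z t 3) := by
    intro t ht
    refine pos_of_no_first_zero (f := fun t => η * (P.traj z t 2 - P.traj z t 3)) (T := 1)
      ?_ (by simpa using hSpos) ?_ ht
    · have := continuous_traj_apply (P := P) z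
      fun_prop
    · intro s hs _ h0
      have h1 : (P.traj z s 2 - P.traj z s 3) ^ 2 = 0 := by
        have : (η * (P.traj z s 2 - P.traj z s 3)) ^ 2 = 0 := by
          have h0 : η * (P.traj z s 2 - P.traj z s 3) = 0 := h0
          rw [h0]; ring
        rwa [mul_pow, hη, one_mul] at this
      have h2 := (key s hs).1
      have h3 : 0 < (c * S) ^ 2 := by positivity
      linarith
  intro t ht
  obtain ⟨k1, k2, k3⟩ := key t ht
  have hsq : (P.traj z t 2 - P.traj z t 3) ^ 2 = (η * (P.traj z t 2 - P.traj z t 3)) ^ 2 := by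
    rw [mul_pow, hη, one_mul]
  rw [hsq] at k1 k2
  refine ⟨?_, ?_, ?_⟩
  · exact (pow_le_pow_iff_left₀ (by positivity) (hpos t ht).le two_ne_zero).1 k1
  · have := (pow_le_pow_iff_left₀ (hpos t ht).le (by positivity) two_ne_zero).1 k2
    linarith [mul_pos hB hSpos]
  · have := sqrt_nonneg W
    linarith

/-! ### Reaching a relative angle from which the relative velocity can be boosted -/

lemma go_traj (h₁ : P.F₁ ∈ F) (z : Coord) {t : ℝ} (ht : 0 ≤ t) : Go F z (P.traj z t) := by
  simpa using Go.of_curve h₁ (isIntegralCurve_traj z) ht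

variable (P F) in
/-- Some point with relative angle `d` can be reached from `z`. -/
def ReachesGap (z : Coord) (d : ℝ) : Prop := ∃ θ L D, Go F z (P.pt θ d L D)

lemma ReachesGap.of_go {z w : Coord} {d : ℝ} (h : Go F z w) (hw : P.ReachesGap F w d) :
    P.ReachesGap F z d := by
  obtain ⟨θ, L, D, h'⟩ := hw
  exact ⟨θ, L, D, h.trans h'⟩

lemma reachesGap_traj (h₁ : P.F₁ ∈ F) (z : Coord) {t : ℝ} (ht : 0 ≤ t) :
    P.ReachesGap F z (P.traj z t 0 - P.traj z t 1) :=
  ⟨_, _, _, by rw [← P.eq_pt]; exact go_traj h₁ z ht⟩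

lemma continuous_gap_traj (z : Coord) : Continuous fun t => P.traj z t 0 - P.traj z t 1 := by
  have := continuous_traj_apply (P := P) z
  fun_prop

variable (P) in
/-- At the relative angle `d` the flows of `X₂` and `X₄` can be combined to a change of the relative
velocity that keeps the angular momentum. -/
def Launchable (d : ℝ) : Prop :=
  sin d * cos d * P.skew (cos d) ≤ 0 ∧ sin d * P.twist (cos d) ≠ 0

/-- The quadratic polynomial `twist` has at most two zeros. -/
lemma exists_twist_ne_zero {x y z : ℝ} (hxy : x ≠ y) (hxz : x ≠ z) (hyz : y ≠ z) :
    P.twist x ≠ 0 ∨ P.twist y ≠ 0 ∨ P.twist z ≠ 0 := by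
  by_contra! h
  obtain ⟨hx, hy, hz⟩ := h
  unfold twist at hx hy hz
  have ha : (0 : ℝ) < 2 * P.m₁ * P.m₂ * P.k := by
    have := P.m₁_pos; have := P.m₂_pos; have := P.k_pos; positivity
  set a := 2 * P.m₁ * P.m₂ * P.k
  set b := 2 * P.m₂ * (P.m₁ ^ 2 * P.r₂ ^ 2 + P.m₂ * (P.m₁ + P.m₂) * P.r₁ ^ 2)
  have h1 : (x - y) * (a * (x + y) - b) = 0 := by linear_combination hx - hy
  have h2 : (x - z) * (a * (x + z) - b) = 0 := by linear_combination hx - hz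
  have h3 := (mul_eq_zero.1 h1).resolve_left (sub_ne_zero.2 hxy)
  have h4 := (mul_eq_zero.1 h2).resolve_left (sub_ne_zero.2 hxz)
  have h5 : a * (y - z) = 0 := by linear_combination h3 - h4
  exact (mul_ne_zero ha.ne' (sub_ne_zero.2 hyz)) h5

/-- A motion that crosses a relative angle where the two rods are aligned visits a launchable
position: of two relative angles symmetric to it, one satisfies the sign condition. -/
lemma exists_launchable_of_crossing {z : Coord} {e a : ℝ} (he : sin e = 0) (ha : 0 < a)
    (hπ : a ≤ π) (h : ∀ u ∈ Icc (-a) a, P.ReachesGap F z (e + u)) :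
    ∃ d, P.Launchable d ∧ P.ReachesGap F z d := by
  have hce : cos e ≠ 0 := fun h0 => by
    have := sin_sq_add_cos_sq e
    rw [he, h0] at this
    norm_num at this
  have hcos : ∀ u, cos (e + u) = cos e * cos u := fun u => by rw [cos_add, he]; ring
  have hsin : ∀ u, sin (e + u) = cos e * sin u := fun u => by rw [sin_add, he]; ring
  have hne : ∀ u v, u ∈ Icc 0 π → v ∈ Icc 0 π → u ≠ v → cos e * cos u ≠ cos e * cos v :=
    fun u v hu hv huv h => huv (injOn_cos hu hv (mul_left_cancel₀ hce h))
  have hmem : ∀ r : ℝ, 0 < r → r < 1 → r * a ∈ Icc 0 π ∧ r * a ∈ Ioo 0 a := fun r h0 h1 => by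
    have : r * a < a := by nlinarith
    have : 0 < r * a := by positivity
    exact ⟨⟨by linarith, by linarith⟩, ⟨by linarith, by linarith⟩⟩
  obtain ⟨u, hu, hut⟩ : ∃ u ∈ Ioo 0 a, P.twist (cos e * cos u) ≠ 0 := by
    have h1 := hmem (1 / 4) (by norm_num) (by norm_num)
    have h2 := hmem (1 / 2) (by norm_num) (by norm_num)
    have h3 := hmem (3 / 4) (by norm_num) (by norm_num)
    rcases exists_twist_ne_zero (P := P)
      (hne _ _ h1.1 h2.1 (by intro h; linarith)) (hne _ _ h1.1 h3.1 (by intro h; linarith))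
      (hne _ _ h2.1 h3.1 (by intro h; linarith)) with h | h | h
    exacts [⟨_, h1.2, h⟩, ⟨_, h2.2, h⟩, ⟨_, h3.2, h⟩]
  have hsu : sin u ≠ 0 := (sin_pos_of_pos_of_lt_pi hu.1 (by linarith [hu.2])).ne'
  rcases le_total (cos e * sin u * (cos e * cos u) * P.skew (cos e * cos u)) 0 with hle | hle
  · refine ⟨e + u, ⟨?_, ?_⟩, h u ⟨by linarith [hu.1], hu.2.le⟩⟩
    · rwa [hsin, hcos]
    · rw [hsin, hcos]; exact mul_ne_zero (mul_ne_zero hce hsu) hut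
  · refine ⟨e + -u, ⟨?_, ?_⟩, h (-u) ⟨by linarith [hu.2], by linarith [hu.1]⟩⟩
    · rw [hsin, hcos, sin_neg, cos_neg]; linarith
    · rw [hsin, hcos, sin_neg, cos_neg]
      exact mul_ne_zero (mul_ne_zero hce (neg_ne_zero.2 hsu)) hut

lemma launchable_of_cos_eq_zero {d : ℝ} (h : cos d = 0) : P.Launchable d := by
  refine ⟨by simp [h], mul_ne_zero (fun h0 => ?_) ?_⟩
  · have := sin_sq_add_cos_sq d
    rw [h0, h] at this
    norm_num at this
  · rw [h]; exact (twist_pos_of_nonpos P le_rfl).ne'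

variable (P) in
/-- A bound of the contribution of gravity to the rescaled relative acceleration. -/
lemma exists_abs_tilt_le : ∃ G > 0, ∀ z : Coord,
    |P.scale (cos (z 0 - z 1)) / P.inertia (cos (z 0 - z 1)) *
      (P.tilt z * P.inertia (cos (z 0 - z 1)) / P.k)| ≤ G := by
  have hk := P.k_pos; have hM₁ := P.M₁_pos; have hM₂ := P.M₂_pos; have hg := P.g_pos
  have ha : 0 < P.m₂ * P.r₂ := mul_pos P.m₂_pos P.r₂_pos
  have hb : 0 < (P.m₁ + P.m₂) * P.r₁ := mul_pos (add_pos P.m₁_pos P.m₂_pos) P.r₁_pos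
  set T := P.g * (P.m₂ * P.r₂ * 1 * (P.M₁ + P.k * 1) +
    (P.m₁ + P.m₂) * P.r₁ * 1 * (P.k * 1 + P.M₂)) with hT
  have hT0 : 0 < T := by positivity
  have hs : 0 < √(P.volMax / P.inertiaMin) := sqrt_pos.2 (div_pos P.volMax_pos P.inertiaMin_pos)
  refine ⟨√(P.volMax / P.inertiaMin) * (T / P.k), by positivity, fun z => ?_⟩
  have hI := P.inertia_cos_pos (z 0 - z 1)
  have h1 : P.scale (cos (z 0 - z 1)) ≤ √(P.volMax / P.inertiaMin) :=
    sqrt_le_sqrt (div_le_div₀ P.volMax_pos.le (P.vol_le _) P.inertiaMin_pos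
      (P.inertiaMin_le (neg_one_le_cos _)))
  have h2 : |P.tilt z| ≤ T := by
    have e1 : |P.M₁ + P.k * cos (z 0 - z 1)| ≤ P.M₁ + P.k * 1 := by
      refine (abs_add_le _ _).trans ?_
      rw [abs_of_pos hM₁, abs_mul, abs_of_pos hk]
      gcongr
      exact abs_cos_le_one _
    have e2 : |P.k * cos (z 0 - z 1) + P.M₂| ≤ P.k * 1 + P.M₂ := by
      refine (abs_add_le _ _).trans ?_
      rw [abs_of_pos hM₂, abs_mul, abs_of_pos hk]
      gcongr
      exact abs_cos_le_one _
    unfold tilt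
    rw [abs_mul, abs_of_pos hg, hT]
    refine mul_le_mul_of_nonneg_left ((abs_sub _ _).trans ?_) hg.le
    simp only [abs_mul _ (P.M₁ + _), abs_mul _ (_ + P.M₂), abs_mul _ (sin _),
      abs_of_pos ha, abs_of_pos hb]
    gcongr
    · exact abs_sin_le_one _
    · exact abs_sin_le_one _
  have h3 : P.scale (cos (z 0 - z 1)) / P.inertia (cos (z 0 - z 1)) *
      (P.tilt z * P.inertia (cos (z 0 - z 1)) / P.k) =
      P.scale (cos (z 0 - z 1)) * (P.tilt z / P.k) := by field_simp
  rw [h3, abs_mul, abs_of_pos (scale_pos _), abs_div, abs_of_pos hk]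
  gcongr

lemma arc_neg (d : ℝ) : P.arc (-d) = -P.arc d := by
  unfold arc
  rw [intervalIntegral.integral_symm]
  have h := intervalIntegral.integral_comp_neg (a := 0) (b := d)
    (fun u : ℝ => (P.inertia (cos u) * P.scale (cos u))⁻¹)
  simp only [cos_neg, neg_zero] at h
  rw [h]

variable (P) in
/-- For relative angles in the first quadrant, the centrifugal force pushes back at least
proportionally to the elongation. -/
lemma exists_mul_arc_le : ∃ μ > 0, ∀ u ∈ Icc 0 (π / 2),
    μ * P.arc u ≤ P.scale (cos u) / P.inertia (cos u) * sin u := by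
  have hv := P.volMin_pos
  have hi := P.inertiaMin_pos
  have hI := P.inertiaMax_pos
  set σ := √(P.volMin / P.inertiaMax) with hσ
  have hσ0 : 0 < σ := sqrt_pos.2 (div_pos hv hI)
  have hσle : ∀ u : ℝ, σ ≤ P.scale (cos u) := fun u =>
    sqrt_le_sqrt (div_le_div₀ (P.vol_cos_pos u).le (P.volMin_le (neg_one_le_cos _) (cos_le_one _))
      (P.inertia_cos_pos u) (P.inertia_le (cos_le_one _)))
  have hpi := pi_pos
  refine ⟨σ / P.inertiaMax * (2 / π) * (P.inertiaMin * σ), by positivity, fun u hu => ?_⟩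
  have h1 : |P.arc u - P.arc 0| ≤ (P.inertiaMin * σ)⁻¹ * |u - 0| := by
    refine abs_sub_le_of_hasDerivAt convex_univ (fun d _ => P.hasDerivAt_arc d) (fun d _ => ?_)
      (mem_univ _) (mem_univ _)
    have hpos := mul_pos (P.inertia_cos_pos d) (scale_pos (P := P) d)
    rw [abs_of_pos (inv_pos.2 hpos)]
    refine inv_anti₀ (by positivity) ?_
    exact mul_le_mul (P.inertiaMin_le (neg_one_le_cos _)) (hσle d) hσ0.le (P.inertia_cos_pos d).le
  rw [arc_zero, sub_zero, sub_zero, abs_of_nonneg hu.1] at h1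
  have h2 : (P.inertiaMin * σ) * P.arc u ≤ u := by
    have := (le_abs_self _).trans h1
    rwa [inv_mul_eq_div, le_div_iff₀' (by positivity)] at this
  have h3 : 2 / π * u ≤ sin u := mul_le_sin hu.1 hu.2
  calc σ / P.inertiaMax * (2 / π) * (P.inertiaMin * σ) * P.arc u
      = σ / P.inertiaMax * (2 / π * ((P.inertiaMin * σ) * P.arc u)) := by ring
    _ ≤ σ / P.inertiaMax * (2 / π * u) := by gcongr
    _ ≤ σ / P.inertiaMax * sin u := by gcongr
    _ ≤ P.scale (cos u) / P.inertia (cos u) * sin u := by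
      have hs : 0 ≤ sin u := sin_nonneg_of_nonneg_of_le_pi hu.1 (by linarith [hu.2])
      refine mul_le_mul_of_nonneg_right ?_ hs
      exact div_le_div₀ (scale_pos u).le (hσle u) (P.inertia_cos_pos u) (P.inertia_le (cos_le_one u))

end Params

/-- Comparison with the harmonic oscillator: under a restoring force that is stronger than that of
the oscillator of frequency `ω`, up to an error `C`, the elongation vanishes within half a period. -/
lemma exists_neg_of_restoring {x w w' : ℝ → ℝ} {ω C : ℝ} (hω : 0 < ω)
    (hx : ∀ t, HasDerivAt x (w t) t) (hw : ∀ t, HasDerivAt w (w' t) t)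
    (h : ∀ t ∈ Icc 0 (π / ω), w' t ≤ -(ω ^ 2 * x t) + C) (h0 : 2 * C < ω ^ 2 * x 0) :
    x (π / ω) < 0 := by
  -- the Wronskian of `x - C / ω ^ 2` and of the solution `sin (ω t)` of the oscillator decreases
  have hd : ∀ t ∈ Icc 0 (π / ω), HasDerivAt
      (fun t => -(w t * sin (ω * t) - ω * x t * cos (ω * t) + C / ω * cos (ω * t)))
      (-((w' t + ω ^ 2 * x t - C) * sin (ω * t))) t := fun t _ => by
    have hl : HasDerivAt (fun t => ω * t) ω t := by
      simpa using (hasDerivAt_id t).const_mul ω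
    refine hasDerivAt_of_eq ((((hw t).mul hl.sin).sub (((hx t).const_mul ω).mul hl.cos)).add
      (hl.cos.const_mul (C / ω))).neg (fun _ => rfl) ?_
    field_simp
    ring
  have hT : 0 ≤ π / ω := (div_pos pi_pos hω).le
  have := mul_sub_le_of_hasDerivAt (C := 0) (convex_Icc 0 (π / ω)) hd (fun t ht => ?_)
    ⟨le_rfl, hT⟩ ⟨hT, le_rfl⟩ hT
  · rw [mul_div_cancel₀ _ hω.ne'] at this
    simp only [sin_pi, cos_pi, mul_zero, sin_zero, cos_zero] at this
    have h2 : C / ω * 2 < ω * x 0 := by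
      rw [div_mul_eq_mul_div, div_lt_iff₀ hω]; linarith
    have h3 : ω * x (π / ω) < 0 := by linarith
    exact neg_of_mul_neg_right h3 hω.le
  · have hs : 0 ≤ sin (ω * t) := by
      apply sin_nonneg_of_nonneg_of_le_pi (mul_nonneg hω.le ht.1)
      have := ht.2
      rwa [le_div_iff₀' hω] at this
    have : (w' t + ω ^ 2 * x t - C) * sin (ω * t) ≤ 0 :=
      mul_nonpos_of_nonpos_of_nonneg (by linarith [h t ht]) hs
    linarith

namespace Params

variable {P : Params}

lemma reachesGap_mul (h₁ : P.F₁ ∈ F) {η : ℝ} (hη : η ^ 2 = 1) (z : Coord) {t : ℝ} (ht : 0 ≤ t)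
    {v : ℝ} (hv : v ∈ uIcc (η * (z 0 - z 1)) (η * (P.traj z t 0 - P.traj z t 1))) :
    P.ReachesGap F z (η * v) := by
  have h := intermediate_value_uIcc (a := 0) (b := t)
    ((continuous_gap_traj (P := P) z).const_mul η).continuousOn
  rw [traj_zero] at h
  obtain ⟨s, hs, rfl⟩ := h hv
  rw [uIcc_of_le ht] at hs
  rw [← mul_assoc, ← sq, hη, one_mul]
  exact reachesGap_traj h₁ z hs.1

lemma eq_one_or_neg_one {η : ℝ} (hη : η ^ 2 = 1) : η = 1 ∨ η = -1 :=
  mul_self_eq_one_iff.1 (by rw [← sq, hη])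

lemma sin_mul_of_sq_eq_one {η : ℝ} (hη : η ^ 2 = 1) (x : ℝ) : sin (η * x) = η * sin x := by
  rcases eq_one_or_neg_one hη with rfl | rfl <;> simp

lemma cos_mul_of_sq_eq_one {η : ℝ} (hη : η ^ 2 = 1) (x : ℝ) : cos (η * x) = cos x := by
  rcases eq_one_or_neg_one hη with rfl | rfl <;> simp

lemma arc_mul_of_sq_eq_one {η : ℝ} (hη : η ^ 2 = 1) (x : ℝ) : P.arc (η * x) = η * P.arc x := by
  rcases eq_one_or_neg_one hη with rfl | rfl <;> simp [arc_neg]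

/-- A motion whose relative angle passes strictly through a position with aligned rods visits a
launchable position. -/
lemma exists_launchable_of_lt_of_lt (h₁ : P.F₁ ∈ F) {η : ℝ} (hη : η ^ 2 = 1) (z : Coord) {t : ℝ}
    (ht : 0 ≤ t) {e a b : ℝ} (he : sin e = 0) (hae : a < e) (hbe : e < b)
    (hab : Icc a b ⊆ uIcc (η * (z 0 - z 1)) (η * (P.traj z t 0 - P.traj z t 1))) :
    ∃ d, P.Launchable d ∧ P.ReachesGap F z d := by
  refine exists_launchable_of_crossing (e := η * e) (a := min π (min (e - a) (b - e))) ?_ ?_ ?_ ?_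
  · rw [sin_mul_of_sq_eq_one hη, he, mul_zero]
  · exact lt_min pi_pos (lt_min (by linarith) (by linarith))
  · exact min_le_left _ _
  · intro u hu
    have hle1 : min π (min (e - a) (b - e)) ≤ e - a := (min_le_right _ _).trans (min_le_left _ _)
    have hle2 : min π (min (e - a) (b - e)) ≤ b - e := (min_le_right _ _).trans (min_le_right _ _)
    have hu' : u = η * (η * u) := by rw [← mul_assoc, ← sq, hη, one_mul]
    rw [hu', ← mul_add]
    refine reachesGap_mul h₁ hη z ht (hab ?_)
    have : |η * u| ≤ min π (min (e - a) (b - e)) := by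
      rw [abs_mul, (abs_eq zero_le_one).2 (eq_one_or_neg_one hη), one_mul]
      exact abs_le.2 hu
    have := abs_le.1 this
    constructor <;> linarith

lemma hasDerivAt_scaledVel_traj {η : ℝ} (hη : η ^ 2 = 1) (z : Coord) (t : ℝ) :
    HasDerivAt (fun t => η * ((P.traj z t 2 - P.traj z t 3) *
      P.scale (cos (P.traj z t 0 - P.traj z t 1))))
    (-(P.scale (cos (P.traj z t 0 - P.traj z t 1)) / P.inertia (cos (P.traj z t 0 - P.traj z t 1)) *
      sin (η * (P.traj z t 0 - P.traj z t 1)) * P.angMom (P.traj z t) ^ 2) -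
      η * (P.scale (cos (P.traj z t 0 - P.traj z t 1)) /
        P.inertia (cos (P.traj z t 0 - P.traj z t 1)) *
        (P.tilt (P.traj z t) * P.inertia (cos (P.traj z t 0 - P.traj z t 1)) / P.k))) t := by
  refine hasDerivAt_of_eq ((hasDerivAt_scaledVel (hasDerivAt_traj (P := P) z t)).const_mul η)
    (fun _ => rfl) ?_
  rw [sin_mul_of_sq_eq_one hη]
  ring

lemma hasDerivAt_arc_traj {η : ℝ} (hη : η ^ 2 = 1) (z : Coord) (t : ℝ) :
    HasDerivAt (fun t => P.arc (η * (P.traj z t 0 - P.traj z t 1)))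
      (η * ((P.traj z t 2 - P.traj z t 3) * P.scale (cos (P.traj z t 0 - P.traj z t 1)))) t :=
  hasDerivAt_of_eq ((hasDerivAt_arc_gap (hasDerivAt_traj (P := P) z t)).const_mul η)
    (fun _ => arc_mul_of_sq_eq_one hη _) rfl

lemma neg_mul_le_of_abs_le {η x G : ℝ} (hη : η ^ 2 = 1) (h : |x| ≤ G) : -(η * x) ≤ G := by
  have := abs_le.1 h
  rcases eq_one_or_neg_one hη with rfl | rfl <;> linarith

/-- A relative motion that is fast enough leaves the half circle `0 ≤ η δ ≤ π` within a unit of time if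
it is directed to the end `δ = 0`: the centrifugal force points to the same end, however large it is,
and gravity is bounded. -/
lemma exists_leave_of_fast (P : Params) : ∃ B : ℝ, ∀ (z : Coord) (η : ℝ), η ^ 2 = 1 →
    η * ((z 2 - z 3) * P.scale (cos (z 0 - z 1))) ≤ -B →
    ∃ t ∈ Icc (0 : ℝ) 1, η * (P.traj z t 0 - P.traj z t 1) ∉ Icc 0 π := by
  obtain ⟨G, hG, hGb⟩ := P.exists_abs_tilt_le
  refine ⟨P.arc π + G + 1, fun z η hη hB => ?_⟩
  by_contra! hin
  have h01 : (0 : ℝ) ∈ Icc (0 : ℝ) 1 := ⟨le_rfl, zero_le_one⟩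
  have h11 : (1 : ℝ) ∈ Icc (0 : ℝ) 1 := ⟨zero_le_one, le_rfl⟩
  have hW : ∀ t ∈ Icc (0 : ℝ) 1, η * ((P.traj z t 2 - P.traj z t 3) *
      P.scale (cos (P.traj z t 0 - P.traj z t 1))) ≤ -(P.arc π + 1) := fun t ht => by
    have h := mul_sub_le_of_hasDerivAt (C := -G) (convex_Icc (0 : ℝ) 1)
      (fun t _ => (hasDerivAt_scaledVel_traj (P := P) hη z t).neg) (fun s hs => ?_) h01 ht ht.1
    · simp only [Pi.neg_apply, traj_zero] at h
      have := mul_le_of_le_one_right hG.le ht.2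
      linarith
    · have h1 := neg_mul_le_of_abs_le hη (hGb (P.traj z s))
      have h2 : 0 ≤ P.scale (cos (P.traj z s 0 - P.traj z s 1)) /
          P.inertia (cos (P.traj z s 0 - P.traj z s 1)) *
          sin (η * (P.traj z s 0 - P.traj z s 1)) * P.angMom (P.traj z s) ^ 2 :=
        mul_nonneg (mul_nonneg (div_pos (scale_pos _) (P.inertia_cos_pos _)).le
          (sin_nonneg_of_mem_Icc (hin s hs))) (sq_nonneg _)
      linarith
  have h := mul_sub_le_of_hasDerivAt (C := P.arc π + 1) (convex_Icc (0 : ℝ) 1)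
    (fun t _ => (hasDerivAt_arc_traj (P := P) hη z t).neg)
    (fun s hs => by linarith [hW s hs]) h01 h11 zero_le_one
  simp only [Pi.neg_apply, traj_zero] at h
  have h0 := hin 0 h01
  rw [traj_zero] at h0
  have h2 := P.strictMono_arc.monotone h0.2
  have h3 := P.strictMono_arc.monotone (hin 1 h11).1
  rw [arc_zero] at h3
  linarith

/-- With a large angular momentum, the relative angle leaves the first quadrant. -/
lemma exists_leave_of_large_angMom (P : Params) {d₀ : ℝ} (hd₀ : 0 < d₀) :
    ∃ B : ℝ, ∀ (z : Coord) (η : ℝ), η ^ 2 = 1 → η * (z 0 - z 1) = d₀ → P.angMom z ≤ -B →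
    ∃ t ∈ Icc (0 : ℝ) 1, η * (P.traj z t 0 - P.traj z t 1) ∉ Icc 0 (π / 2) := by
  obtain ⟨G, hG, hGb⟩ := P.exists_abs_tilt_le
  obtain ⟨μ, hμ, hμb⟩ := P.exists_mul_arc_le
  have hx₀ : 0 < P.arc d₀ := by
    have := P.strictMono_arc hd₀
    rwa [arc_zero] at this
  set ω := π + 2 * G / P.arc d₀ with hω
  have hωπ : π ≤ ω := by
    have : 0 ≤ 2 * G / P.arc d₀ := by positivity
    linarith
  have hpi := pi_gt_three
  have hω0 : 0 < ω := by linarith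
  refine ⟨ω / √μ + P.drag, fun z η hη hz hL => ?_⟩
  by_contra! hin
  have hT : π / ω ≤ 1 := (div_le_one hω0).2 hωπ
  have hT0 : 0 ≤ π / ω := by positivity
  have h := exists_neg_of_restoring (C := G) hω0 (hasDerivAt_arc_traj (P := P) hη z)
    (hasDerivAt_scaledVel_traj (P := P) hη z) (fun t ht => ?_) ?_
  · have h1 := P.strictMono_arc.monotone (hin (π / ω) ⟨hT0, hT⟩).1
    rw [arc_zero] at h1
    linarith
  · have ht1 : t ∈ Icc (0 : ℝ) 1 := ⟨ht.1, ht.2.trans hT⟩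
    have hu := hin t ht1
    have h1 := neg_mul_le_of_abs_le hη (hGb (P.traj z t))
    have hLt : P.angMom (P.traj z t) ≤ -(ω / √μ) := by
      have h2 := (abs_le.1 (abs_angMom_sub_le (P := P) z ht1.1)).2
      have h3 := mul_le_of_le_one_right (drag_pos (P := P)).le ht1.2
      linarith
    have hL2 : ω ^ 2 ≤ μ * P.angMom (P.traj z t) ^ 2 := by
      have h2 : (ω / √μ) ^ 2 ≤ P.angMom (P.traj z t) ^ 2 := by
        rw [← neg_sq (P.angMom _)]
        exact pow_le_pow_left₀ (by positivity) (by linarith) 2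
      rw [div_pow, sq_sqrt hμ.le, div_le_iff₀ hμ] at h2
      linarith
    have hX : 0 ≤ P.arc (η * (P.traj z t 0 - P.traj z t 1)) := by
      have := P.strictMono_arc.monotone hu.1
      rwa [arc_zero] at this
    have h4 := hμb _ hu
    rw [cos_mul_of_sq_eq_one hη] at h4
    have h5 := mul_le_mul_of_nonneg_right h4 (sq_nonneg (P.angMom (P.traj z t)))
    have h6 := mul_le_mul_of_nonneg_right hL2 hX
    linarith
  · rw [traj_zero, hz]
    have h1 : ω * P.arc d₀ = π * P.arc d₀ + 2 * G := by
      rw [hω]; field_simp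
    have h2 : ω * P.arc d₀ ≤ ω ^ 2 * P.arc d₀ := by
      gcongr
      nlinarith
    have h3 : 0 < π * P.arc d₀ := by positivity
    linarith

/-- From a position where the rods are not aligned, a push along `X₂` and a motion along `X₁` lead
to a launchable position. -/
lemma exists_launchable_of_mem_Ioo (h₁ : P.F₁ ∈ F) (h₂ : P.F₂ ∈ F) {η : ℝ} (hη : η ^ 2 = 1)
    {θ d L D : ℝ} (hd : η * d ∈ Ioo 0 π) :
    ∃ d', P.Launchable d' ∧ P.ReachesGap F (P.pt θ d L D) d' := by
  have hsin : 0 < η * sin d := by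
    rw [← sin_mul_of_sq_eq_one hη]
    exact sin_pos_of_mem_Ioo hd
  have hsd : sin d ≠ 0 := fun h => by rw [h, mul_zero] at hsin; exact lt_irrefl _ hsin
  have hcπ : P.Launchable (η * (π / 2)) :=
    launchable_of_cos_eq_zero (by rw [cos_mul_of_sq_eq_one hη, cos_pi_div_two])
  have hpi := pi_pos
  rcases lt_trichotomy (cos d) 0 with hc | hc | hc
  · by_cases hq : 0 ≤ η * P.skew (cos d)
    · refine ⟨d, ⟨?_, mul_ne_zero hsd (twist_pos_of_nonpos P hc.le).ne'⟩, θ, L, D, .refl _⟩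
      have h1 : sin d * cos d * P.skew (cos d) =
          cos d * ((η * sin d) * (η * P.skew (cos d))) := by
        linear_combination -(cos d * sin d * P.skew (cos d)) * hη
      rw [h1]
      exact mul_nonpos_of_nonpos_of_nonneg hc.le (mul_nonneg hsin.le hq)
    · push Not at hq
      obtain ⟨B, hB⟩ := exists_leave_of_fast P
      have hσ := scale_pos (P := P) d
      -- the duration of a push after which the relative motion is fast
      set y := (|B / P.scale (cos d)| + |D|) / -(η * P.skew (cos d)) with hy
      have hy0 : 0 ≤ y := div_nonneg (by positivity) (by linarith)
      have hgo := P.go_F₂ h₂ θ d L D hy0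
      set z := P.pt θ d (L - y * (P.k * (P.m₁ + P.m₂) * P.vol (cos d)))
        (D + y * P.skew (cos d)) with hz
      have hgap : z 0 - z 1 = d := by simp [hz]
      obtain ⟨t, ht, hout⟩ := hB z η hη (by
        rw [hgap, hz, pt_gap]
        have h1 : y * (η * P.skew (cos d)) = -(|B / P.scale (cos d)| + |D|) := by
          rw [hy, div_neg, neg_mul, div_mul_cancel₀ _ hq.ne]
        have h2 : η * D ≤ |D| := by
          have := neg_mul_le_of_abs_le hη (le_of_eq (abs_neg D))
          linarith
        have h3 : η * (D + y * P.skew (cos d)) ≤ -(B / P.scale (cos d)) := by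
          have := le_abs_self (B / P.scale (cos d))
          linarith
        have h4 := mul_le_mul_of_nonneg_right h3 hσ.le
        rw [neg_mul, div_mul_cancel₀ _ hσ.ne'] at h4
        linarith)
      suffices h : ∃ d', P.Launchable d' ∧ P.ReachesGap F z d' by
        obtain ⟨d', h1, h2⟩ := h
        exact ⟨d', h1, .of_go hgo h2⟩
      have hd2 : π / 2 < η * d := by
        by_contra! hle
        have := cos_nonneg_of_neg_pi_div_two_le_of_le (by linarith [hd.1]) hle
        rw [cos_mul_of_sq_eq_one hη] at this
        linarith
      rw [mem_Icc, not_and_or, not_le, not_le] at hout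
      rcases hout with hout | hout
      · refine ⟨_, hcπ, reachesGap_mul h₁ hη z ht.1 ?_⟩
        rw [hgap]
        exact mem_uIcc.2 (.inr ⟨by linarith, hd2.le⟩)
      · refine exists_launchable_of_lt_of_lt h₁ hη z ht.1 sin_pi hd.2 hout ?_
        rw [hgap]
        exact Icc_subset_uIcc
  · exact ⟨d, launchable_of_cos_eq_zero hc, θ, L, D, .refl _⟩
  · obtain ⟨B, hB⟩ := exists_leave_of_large_angMom P hd.1
    have hp : 0 < P.k * (P.m₁ + P.m₂) * P.vol (cos d) :=
      mul_pos (mul_pos P.k_pos (add_pos P.m₁_pos P.m₂_pos)) (P.vol_cos_pos d)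
    set y := (|B| + |L|) / (P.k * (P.m₁ + P.m₂) * P.vol (cos d)) with hy
    have hy0 : 0 ≤ y := by positivity
    have hgo := P.go_F₂ h₂ θ d L D hy0
    rw [hy, div_mul_cancel₀ _ hp.ne', ← hy] at hgo
    set z := P.pt θ d (L - (|B| + |L|)) (D + y * P.skew (cos d)) with hz
    have hgap : z 0 - z 1 = d := by simp [hz]
    obtain ⟨t, ht, hout⟩ := hB z η hη (by rw [hgap]) (by
      rw [hz, angMom_pt]
      linarith [le_abs_self B, le_abs_self L])
    suffices h : ∃ d', P.Launchable d' ∧ P.ReachesGap F z d' by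
      obtain ⟨d', h1, h2⟩ := h
      exact ⟨d', h1, .of_go hgo h2⟩
    have hd2 : η * d < π / 2 := by
      by_contra! hle
      have := cos_nonpos_of_pi_div_two_le_of_le hle (by linarith [hd.2])
      rw [cos_mul_of_sq_eq_one hη] at this
      linarith
    rw [mem_Icc, not_and_or, not_le, not_le] at hout
    rcases hout with hout | hout
    · refine exists_launchable_of_lt_of_lt h₁ hη z ht.1 sin_zero hout hd.1 ?_
      rw [hgap]
      exact Icc_subset_uIcc'
    · refine ⟨_, hcπ, reachesGap_mul h₁ hη z ht.1 ?_⟩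
      rw [hgap]
      exact mem_uIcc.2 (.inl ⟨hd2.le, hout.le⟩)

/-- If the rods remained aligned along an orbit of `X₁`, gravity would have no moment and the
pendulum would be at rest. -/
lemma exists_sin_gap_ne_zero (z : Coord) (hL : P.drag < |P.angMom z|) :
    ∃ t ∈ Icc (0 : ℝ) 1, sin (P.traj z t 0 - P.traj z t 1) ≠ 0 := by
  by_contra! h
  have const : ∀ {f f' : ℝ → ℝ}, (∀ t, HasDerivAt f (f' t) t) → (∀ t ∈ Ioo (0 : ℝ) 1, f t = 0) →
      ∀ t ∈ Ioo (0 : ℝ) 1, f' t = 0 := fun hf h0 t ht =>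
    (hf t).unique ((hasDerivAt_const t (0 : ℝ)).congr_of_eventuallyEq
      (Filter.eventually_of_mem (Ioo_mem_nhds ht.1 ht.2) h0))
  have hs : ∀ t ∈ Ioo (0 : ℝ) 1, sin (P.traj z t 0 - P.traj z t 1) = 0 := fun t ht =>
    h t (Ioo_subset_Icc_self ht)
  have hc : ∀ t ∈ Ioo (0 : ℝ) 1, cos (P.traj z t 0 - P.traj z t 1) ^ 2 = 1 := fun t ht => by
    rw [cos_sq', hs t ht]; norm_num
  have hD : ∀ t ∈ Ioo (0 : ℝ) 1, P.traj z t 2 - P.traj z t 3 = 0 := fun t ht => by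
    have h1 := const (fun t => (hasDerivAt_gap (hasDerivAt_traj (P := P) z t)).sin) hs t ht
    have h2 : cos (P.traj z t 0 - P.traj z t 1) ≠ 0 := fun h0 => by
      have := hc t ht
      rw [h0] at this
      norm_num at this
    exact ((mul_eq_zero.1 ((mul_eq_zero.1 h1).resolve_left h2)).resolve_left
      (P.vol_cos_pos _).ne')
  have hθ : ∀ t ∈ Ioo (0 : ℝ) 1, sin (P.traj z t 0) = 0 := fun t ht => by
    have h1 := const (fun t => hasDerivAt_relVel (hasDerivAt_traj (P := P) z t)) hD t ht
    have h2 := relAcc_mul_inertia (P := P) (P.traj z t)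
    rw [h1, hD t ht, hs t ht] at h2
    have hI := (P.inertia_cos_pos (P.traj z t 0 - P.traj z t 1)).ne'
    have hk := P.k_pos.ne'
    have h3 : P.tilt (P.traj z t) = 0 := by
      have h2 : P.tilt (P.traj z t) * P.inertia (cos (P.traj z t 0 - P.traj z t 1)) / P.k = 0 := by
        linarith
      rcases div_eq_zero_iff.1 h2 with h2 | h2
      · exact (mul_eq_zero.1 h2).resolve_right hI
      · exact absurd h2 hk
    have h4 : sin (P.traj z t 1) = sin (P.traj z t 0) * cos (P.traj z t 0 - P.traj z t 1) := by
      have := sin_sub (P.traj z t 0) (P.traj z t 0 - P.traj z t 1)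
      rwa [sub_sub_cancel, hs t ht, mul_zero, sub_zero] at this
    have h5 : P.tilt (P.traj z t) =
        -(P.g * P.m₁ * P.m₂ * P.r₁ * P.r₂ ^ 2) * sin (P.traj z t 0) := by
      unfold tilt
      rw [h4]
      unfold M₁ M₂ k
      linear_combination P.g * P.m₂ ^ 2 * P.r₂ ^ 2 * P.r₁ * sin (P.traj z t 0) * hc t ht
    rw [h5] at h3
    have := P.g_pos; have := P.m₁_pos; have := P.m₂_pos; have := P.r₁_pos; have := P.r₂_pos
    exact (mul_eq_zero.1 h3).resolve_left (neg_ne_zero.2 (by positivity))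
  have hω : ∀ t ∈ Ioo (0 : ℝ) 1, P.traj z t 2 = 0 := fun t ht => by
    have hd : ∀ t, HasDerivAt (fun t => P.traj z t 0)
        (P.vol (cos (P.traj z t 0 - P.traj z t 1)) * P.traj z t 2) t := fun t => by
      have := hasDerivAt_pi.1 (hasDerivAt_traj (P := P) z t) 0
      rwa [F₁_apply] at this
    have h1 := const (fun t => (hd t).sin) hθ t ht
    have h2 : cos (P.traj z t 0) ≠ 0 := fun h0 => by
      have := sin_sq_add_cos_sq (P.traj z t 0)
      rw [h0, hθ t ht] at this
      norm_num at this
    exact (mul_eq_zero.1 ((mul_eq_zero.1 h1).resolve_left h2)).resolve_left (P.vol_cos_pos _).ne'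
  have hmid : (1 / 2 : ℝ) ∈ Ioo (0 : ℝ) 1 := by norm_num
  have h1 := abs_angMom_sub_le (P := P) z (t := 1 / 2) (by norm_num)
  have h2 : P.angMom (P.traj z (1 / 2)) = 0 := by
    have h3 : P.traj z (1 / 2) 3 = 0 := by
      have := hD _ hmid
      have := hω _ hmid
      linarith
    rw [angMom, hω _ hmid, h3]
    ring
  rw [h2, zero_sub, abs_neg] at h1
  linarith [drag_pos (P := P)]

/-- Every real number is, up to a multiple of `2π` and a sign, in `[0, π]`. -/
lemma exists_sign_add_int_mul_two_pi (d : ℝ) :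
    ∃ η : ℝ, η ^ 2 = 1 ∧ ∃ n : ℤ, η * (d + n * (2 * π)) ∈ Icc 0 π := by
  have hpi := pi_pos
  have h2 : (0 : ℝ) < 2 * π := by linarith
  have hmem := toIcoMod_mem_Ico h2 (-π) d
  have heq := toIcoMod_add_toIcoDiv_zsmul h2 (-π) d
  set n := toIcoDiv h2 (-π) d
  have hd : d + (-n : ℤ) * (2 * π) = toIcoMod h2 (-π) d := by
    rw [← sub_eq_iff_eq_add.2 heq.symm]
    simp
    ring
  rcases le_total 0 (toIcoMod h2 (-π) d) with h | h
  · exact ⟨1, by norm_num, -n, by rw [hd]; constructor <;> linarith [hmem.2]⟩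
  · exact ⟨-1, by norm_num, -n, by rw [hd]; constructor <;> linarith [hmem.1]⟩

lemma go_add_two_pi (F : Set (Coord → Coord)) (θ d L D : ℝ) (m n : ℤ) :
    Go F (P.pt θ d L D) (P.pt (θ + m * (2 * π)) (d + n * (2 * π)) L D) :=
  .of_toState_eq (P.toState_pt_add_two_pi θ d L D m n).symm

/-- Every point can be led to a launchable position. -/
lemma exists_launchable (h₁ : P.F₁ ∈ F) (h₂ : P.F₂ ∈ F) (z : Coord) :
    ∃ d, P.Launchable d ∧ P.ReachesGap F z d := by
  have hgen : ∀ θ d L D, sin d ≠ 0 →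
      ∃ d', P.Launchable d' ∧ P.ReachesGap F (P.pt θ d L D) d' := fun θ d L D hd => by
    obtain ⟨η, hη, n, hn⟩ := exists_sign_add_int_mul_two_pi d
    have hgo := go_add_two_pi (P := P) F θ d L D 0 n
    have hs : sin (η * (d + n * (2 * π))) ≠ 0 := by
      rw [sin_mul_of_sq_eq_one hη, sin_add_int_mul_two_pi]
      refine mul_ne_zero (fun h => ?_) hd
      rw [h] at hη
      norm_num at hη
    have hIoo : η * (d + n * (2 * π)) ∈ Ioo 0 π := by
      refine ⟨hn.1.lt_of_ne fun h => hs ?_, hn.2.lt_of_ne fun h => hs ?_⟩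
      · rw [← h, sin_zero]
      · rw [h, sin_pi]
    obtain ⟨d', h1, h2⟩ := exists_launchable_of_mem_Ioo (θ := θ + (0 : ℤ) * (2 * π)) (L := L)
      (D := D) h₁ h₂ hη hIoo
    exact ⟨d', h1, .of_go hgo h2⟩
  have hp : 0 < P.k * (P.m₁ + P.m₂) * P.vol (cos (z 0 - z 1)) :=
    mul_pos (mul_pos P.k_pos (add_pos P.m₁_pos P.m₂_pos)) (P.vol_cos_pos _)
  have hB := drag_pos (P := P)
  set y := (P.drag + 1 + |P.angMom z|) / (P.k * (P.m₁ + P.m₂) * P.vol (cos (z 0 - z 1))) with hy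
  have hgo := P.go_F₂ h₂ (z 0) (z 0 - z 1) (P.angMom z) (z 2 - z 3) (t := y) (by positivity)
  rw [← P.eq_pt, hy, div_mul_cancel₀ _ hp.ne', ← hy] at hgo
  set w := P.pt (z 0) (z 0 - z 1) (P.angMom z - (P.drag + 1 + |P.angMom z|))
    (z 2 - z 3 + y * P.skew (cos (z 0 - z 1))) with hw
  obtain ⟨t, ht, hs⟩ := exists_sin_gap_ne_zero (P := P) w (by
    rw [hw, angMom_pt]
    refine lt_of_lt_of_le ?_ (neg_le_abs _)
    linarith [le_abs_self (P.angMom z)])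
  obtain ⟨d', h1, h2⟩ := hgen (P.traj w t 0) _ (P.angMom (P.traj w t))
    (P.traj w t 2 - P.traj w t 3) hs
  rw [← P.eq_pt] at h2
  exact ⟨d', h1, .of_go (hgo.trans (go_traj h₁ w ht.1)) h2⟩

/-! ### Approaching a given relative angle at high relative velocity -/

variable (P) in
/-- Fast relative rotation passes, within a unit of time, through several full turns, at a speed of
constant order of magnitude and with an almost constant angular momentum. -/
lemma exists_rotation : ∃ c C κ S₀ : ℝ, 0 < c ∧ 0 < C ∧ 0 < κ ∧ 0 < S₀ ∧
    ∀ (z : Coord) (η : ℝ), η ^ 2 = 1 → S₀ ≤ η * (z 2 - z 3) →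
      |P.angMom z| ≤ κ * (η * (z 2 - z 3)) →
      (∀ t ∈ Icc (0 : ℝ) 1,
        c * (η * (z 2 - z 3)) ≤ η * (P.traj z t 2 - P.traj z t 3) ∧
        |P.angMom (P.traj z t) - P.angMom z| ≤ C) ∧
      (∀ s ∈ Icc (0 : ℝ) 1, ∀ t ∈ Icc (0 : ℝ) 1, s ≤ t →
        c * (η * (z 2 - z 3)) * (t - s) ≤
          η * (P.traj z t 0 - P.traj z t 1) - η * (P.traj z s 0 - P.traj z s 1) ∧
        η * (P.traj z t 0 - P.traj z t 1) - η * (P.traj z s 0 - P.traj z s 1) ≤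
          C * (η * (z 2 - z 3)) * (t - s)) ∧
      ∀ d, η * (d - (z 0 - z 1)) ∈ Icc 0 (2 * π) →
        ∃ t ∈ Icc (0 : ℝ) 1, P.traj z t 0 - P.traj z t 1 = d := by
  obtain ⟨c, C, κ, S₀, hc, hC, hκ, hS₀, h⟩ := P.exists_rotation_bounds
  have hv := P.volMin_pos
  have hV := P.volMax_pos
  set c' := min c (P.volMin * c) with hc'
  have hc'0 : 0 < c' := lt_min hc (by positivity)
  set C' := max C (P.volMax * C) with hC'
  refine ⟨c', C', κ, max S₀ (2 * π / c'), hc'0, lt_max_of_lt_left hC, hκ, lt_max_of_lt_left hS₀,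
    fun z η hη hS hL => ?_⟩
  have hS0 : 0 < η * (z 2 - z 3) := (lt_max_of_lt_left hS₀).trans_le hS
  have hb := h z η hη ((le_max_left _ _).trans hS) hL
  have hd : ∀ t, HasDerivAt (fun t => η * (P.traj z t 0 - P.traj z t 1))
      (P.vol (cos (P.traj z t 0 - P.traj z t 1)) * (η * (P.traj z t 2 - P.traj z t 3))) t :=
    fun t => hasDerivAt_of_eq ((hasDerivAt_gap (hasDerivAt_traj (P := P) z t)).const_mul η)
      (fun _ => rfl) (by ring)
  have hslope : ∀ s ∈ Icc (0 : ℝ) 1, ∀ t ∈ Icc (0 : ℝ) 1, s ≤ t →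
        c' * (η * (z 2 - z 3)) * (t - s) ≤
          η * (P.traj z t 0 - P.traj z t 1) - η * (P.traj z s 0 - P.traj z s 1) ∧
        η * (P.traj z t 0 - P.traj z t 1) - η * (P.traj z s 0 - P.traj z s 1) ≤
          C' * (η * (z 2 - z 3)) * (t - s) := by
    intro s hs t ht hst
    constructor
    · refine mul_sub_le_of_hasDerivAt (convex_Icc (0 : ℝ) 1) (fun t _ => hd t) (fun x hx => ?_)
        hs ht hst
      calc c' * (η * (z 2 - z 3)) ≤ P.volMin * c * (η * (z 2 - z 3)) := by
            gcongr; exact min_le_right _ _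
        _ = P.volMin * (c * (η * (z 2 - z 3))) := by ring
        _ ≤ _ := mul_le_mul (P.volMin_le (neg_one_le_cos _) (cos_le_one _)) (hb x hx).1
            (by positivity) (P.vol_cos_pos _).le
    · have h1 := mul_sub_le_of_hasDerivAt (C := -(C' * (η * (z 2 - z 3)))) (convex_Icc (0 : ℝ) 1)
        (fun t _ => (hd t).neg) (fun x hx => ?_) hs ht hst
      · simp only [Pi.neg_apply] at h1
        linarith
      · have h0 : 0 ≤ η * (P.traj z x 2 - P.traj z x 3) :=
          le_trans (by positivity) (hb x hx).1
        refine neg_le_neg ?_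
        calc P.vol (cos (P.traj z x 0 - P.traj z x 1)) * (η * (P.traj z x 2 - P.traj z x 3))
            ≤ P.volMax * (C * (η * (z 2 - z 3))) :=
              mul_le_mul (P.vol_le _) (hb x hx).2.1 h0 hV.le
          _ = P.volMax * C * (η * (z 2 - z 3)) := by ring
          _ ≤ C' * (η * (z 2 - z 3)) := by gcongr; exact le_max_right _ _
  refine ⟨fun t ht => ⟨le_trans ?_ (hb t ht).1, (hb t ht).2.2.trans (le_max_left _ _)⟩, hslope,
    fun d hdm => ?_⟩
  · gcongr
    exact min_le_left _ _
  · have h1 := (hslope 0 ⟨le_rfl, zero_le_one⟩ 1 ⟨zero_le_one, le_rfl⟩ zero_le_one).1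
    have h2 : 2 * π ≤ c' * (η * (z 2 - z 3)) := by
      have := (le_max_right _ _).trans hS
      rwa [div_le_iff₀' hc'0] at this
    obtain ⟨t, ht, htd⟩ := intermediate_value_Icc zero_le_one
      ((continuous_gap_traj (P := P) z).const_mul η).continuousOn
      (show η * d ∈ Icc (η * (P.traj z 0 0 - P.traj z 0 1)) (η * (P.traj z 1 0 - P.traj z 1 1)) by
        simp only [traj_zero] at h1 ⊢
        constructor <;> linarith [hdm.1, hdm.2])
    refine ⟨t, ht, ?_⟩
    have hη0 : η ≠ 0 := fun h => by rw [h] at hη; norm_num at hη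
    exact mul_left_cancel₀ hη0 htd

lemma exists_int_mul_sub_mem {σ : ℝ} (hσ : σ ^ 2 = 1) (a b : ℝ) :
    ∃ n : ℤ, σ * (b + n * (2 * π) - a) ∈ Icc 0 (2 * π) := by
  have h2 : (0 : ℝ) < 2 * π := by positivity
  rcases eq_one_or_neg_one hσ with rfl | rfl
  · obtain ⟨n, hn, -⟩ := existsUnique_add_zsmul_mem_Ico h2 b a
    rw [zsmul_eq_mul] at hn
    exact ⟨n, by constructor <;> linarith [hn.1, hn.2]⟩
  · obtain ⟨n, hn, -⟩ := existsUnique_add_zsmul_mem_Ico h2 b (a - 2 * π)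
    rw [zsmul_eq_mul] at hn
    exact ⟨n, by constructor <;> linarith [hn.1, hn.2]⟩

/-- At a launchable position, the relative velocity can be made arbitrarily large in one
direction. -/
lemma Launchable.exists_go (h₂ : P.F₂ ∈ F) (h₄ : P.F₄ ∈ F) {d σ : ℝ}
    (hd : sin d * cos d * P.skew (cos d) ≤ 0) (hσ : 0 < σ * (sin d * P.twist (cos d)))
    (θ L D M : ℝ) : ∃ D', M ≤ σ * D' ∧ Go F (P.pt θ d L D) (P.pt θ d L D') := by
  have ha : 0 < σ * (P.k * P.inertia (cos d) * (sin d * P.twist (cos d))) := by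
    rw [mul_left_comm]
    exact mul_pos (mul_pos P.k_pos (P.inertia_cos_pos d)) hσ
  refine ⟨_, ?_, P.go_launch h₂ h₄ hd θ L D (x := (|M| + |σ * D|) /
    (σ * (P.k * P.inertia (cos d) * (sin d * P.twist (cos d))))) (by positivity)⟩
  generalize P.k * P.inertia (cos d) * (sin d * P.twist (cos d)) = b at *
  have h1 : σ * (D + (|M| + |σ * D|) / (σ * b) * b) = σ * D + (|M| + |σ * D|) := by
    rw [mul_add, mul_left_comm, div_mul_cancel₀ _ ha.ne']
  rw [h1]
  linarith [le_abs_self M, neg_abs_le (σ * D)]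

/-- Every point can be led to any given relative angle, with a relative velocity that has any given
direction, is arbitrarily large, and dominates any given multiple of the angular momentum. -/
lemma exists_go_fast (h₁ : P.F₁ ∈ F) (h₂ : P.F₂ ∈ F) (h₄ : P.F₄ ∈ F) (z : Coord) (d : ℝ) {η : ℝ}
    (hη : η ^ 2 = 1) {K : ℝ} (hK : 0 ≤ K) (S : ℝ) :
    ∃ θ L D, S ≤ η * D ∧ K * |L| ≤ η * D ∧ Go F z (P.pt θ d L D) := by
  obtain ⟨c, C, κ, S₀, hc, hC, hκ, hS₀, hrot⟩ := P.exists_rotation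
  have turn : ∀ {σ : ℝ}, σ ^ 2 = 1 → ∀ θ d L D e, S₀ ≤ σ * D → |L| ≤ κ * (σ * D) →
      ∃ θ' L' D', c * (σ * D) ≤ σ * D' ∧ |L' - L| ≤ C ∧
        Go F (P.pt θ d L D) (P.pt θ' e L' D') := by
    intro σ hσ θ d L D e hS hL
    obtain ⟨n, hn⟩ := exists_int_mul_sub_mem hσ d e
    obtain ⟨h1, -, h3⟩ := hrot (P.pt θ d L D) σ hσ (by rwa [pt_gap]) (by rwa [pt_gap, angMom_pt])
    obtain ⟨t, ht, htd⟩ := h3 (e + n * (2 * π)) (by simpa using hn)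
    obtain ⟨h4, h5⟩ := h1 t ht
    rw [pt_gap] at h4
    rw [angMom_pt] at h5
    refine ⟨P.traj (P.pt θ d L D) t 0, P.angMom (P.traj (P.pt θ d L D) t), _, h4, h5,
      (go_traj h₁ (P.pt θ d L D) ht.1).trans (.of_toState_eq ?_)⟩
    have := P.toState_pt_add_two_pi (P.traj (P.pt θ d L D) t 0) e
      (P.angMom (P.traj (P.pt θ d L D) t))
      (P.traj (P.pt θ d L D) t 2 - P.traj (P.pt θ d L D) t 3) 0 n
    rw [← this, ← htd, Int.cast_zero, zero_mul, add_zero, ← P.eq_pt]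
  obtain ⟨d₁, ⟨hd₁, hd₁'⟩, θ₁, L₁, D₁, hgo₁⟩ := exists_launchable (P := P) h₁ h₂ z
  obtain ⟨σ, hσ, hσpos⟩ : ∃ σ : ℝ, σ ^ 2 = 1 ∧ 0 < σ * (sin d₁ * P.twist (cos d₁)) := by
    rcases hd₁'.lt_or_gt with h | h
    · exact ⟨-1, by norm_num, by linarith⟩
    · exact ⟨1, by norm_num, by linarith⟩
  obtain ⟨D₂, hD₂, hgo₂⟩ := Launchable.exists_go h₂ h₄ hd₁ hσpos θ₁ L₁ D₁ (max S₀ (|L₁| / κ))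
  obtain ⟨θ₃, L₃, D₃, -, -, hgo₃⟩ := turn hσ θ₁ d₁ L₁ D₂ (η * (π / 2))
    ((le_max_left _ _).trans hD₂) (by
      have := (le_max_right _ _).trans hD₂
      rwa [div_le_iff₀' hκ] at this)
  have hcos : cos (η * (π / 2)) = 0 := by rw [cos_mul_of_sq_eq_one hη, cos_pi_div_two]
  obtain ⟨D₄, hD₄, hgo₄⟩ := Launchable.exists_go h₂ h₄ (P := P) (d := η * (π / 2)) (σ := η)
    (by simp [hcos]) (by
      rw [hcos, sin_mul_of_sq_eq_one hη, sin_pi_div_two, mul_one, ← mul_assoc, ← sq, hη, one_mul]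
      exact twist_pos_of_nonpos P le_rfl) θ₃ L₃ D₃
    (max (max S₀ (|L₃| / κ)) (max (S / c) (K * (|L₃| + C) / c)))
  obtain ⟨θ₅, L₅, D₅, hD₅, hL₅, hgo₅⟩ := turn hη θ₃ _ L₃ D₄ d
    ((le_max_left _ _).trans ((le_max_left _ _).trans hD₄)) (by
      have := (le_max_right _ _).trans ((le_max_left _ _).trans hD₄)
      rwa [div_le_iff₀' hκ] at this)
  refine ⟨θ₅, L₅, D₅, ?_, ?_, hgo₁.trans (hgo₂.trans (hgo₃.trans (hgo₄.trans hgo₅)))⟩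
  · have := (le_max_left _ _).trans ((le_max_right _ _).trans hD₄)
    rw [div_le_iff₀' hc] at this
    linarith
  · have := (le_max_right _ _).trans ((le_max_right _ _).trans hD₄)
    rw [div_le_iff₀' hc] at this
    have h1 := abs_sub_abs_le_abs_sub L₅ L₃
    have h2 : K * |L₅| ≤ K * (|L₃| + C) := mul_le_mul_of_nonneg_left (by linarith) hK
    linarith

/-! ### Adjusting the angular velocities at a given relative angle -/

variable (P F) in
/-- At the relative angle `d`, sufficiently fast relative rotation in the direction `η` can be turned
into any prescribed angular velocities, while `θ₁` changes by a fixed amount `φ`. -/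
def Adjustable (d η φ K : ℝ) : Prop :=
  ∀ B : ℝ, ∃ S₀ : ℝ, ∀ θ L D L' D', |L'| ≤ B → |D'| ≤ B → S₀ ≤ η * D → K * |L| ≤ η * D →
    Go F (P.pt θ d L D) (P.pt (θ + φ) d L' D')

/-- Where `sin δ cos δ (skew) < 0` and `twist > 0`, the flows of `X₂` and `X₄` push `(L, D)` into the
directions of a cone whose interior contains the direction opposite to a rotation in the direction
`η`. Therefore such a rotation, if fast enough, can be brought to any given `(L, D)`. -/
lemma adjustable_of_skew_ne_zero (h₂ : P.F₂ ∈ F) (h₄ : P.F₄ ∈ F) {d η : ℝ} (hη : η ^ 2 = 1)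
    (hs : η * sin d < 0) (hc : 0 < cos d) (hq : 0 < η * P.skew (cos d))
    (ht : 0 < P.twist (cos d)) : ∃ K, 0 ≤ K ∧ P.Adjustable F d η 0 K := by
  have hk := P.k_pos
  have hI := P.inertia_cos_pos d
  have hA : 0 < P.k * (P.m₁ + P.m₂) * P.vol (cos d) :=
    mul_pos (mul_pos hk (add_pos P.m₁_pos P.m₂_pos)) (P.vol_cos_pos d)
  set A := P.k * (P.m₁ + P.m₂) * P.vol (cos d) with hAdef
  set q := P.skew (cos d) with hqdef
  set s := sin d with hsdef
  have hs' : 0 < -(η * s) := by linarith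
  set a := P.k * -(η * s) * P.inertia (cos d) * P.twist (cos d) with ha
  have ha0 : 0 < a := by positivity
  set p := 4 * P.k * (-(η * s) * cos d * (η * q)) with hp
  have hp0 : 0 < p := by positivity
  refine ⟨4 * (η * q + a / p) / A, by positivity, fun B => ⟨2 * (B * (1 + (η * q + a / p) / A)),
    fun θ L D L' D' hL' hD' hS hK => ?_⟩⟩
  have e1 : |η * D'| ≤ B := by
    rwa [abs_mul, (abs_eq zero_le_one).2 (eq_one_or_neg_one hη), one_mul]
  have e2 : |L - L'| ≤ |L| + B := (abs_sub _ _).trans (by linarith)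
  have e3 : (η * q + a / p) / A * |L - L'| ≤ η * D / 4 + (η * q + a / p) / A * B := by
    have : (η * q + a / p) / A * |L - L'| ≤ (η * q + a / p) / A * (|L| + B) := by gcongr
    have h1 : 4 * (η * q + a / p) / A * |L| = 4 * ((η * q + a / p) / A * |L|) := by ring
    linarith
  have hB0 : 0 ≤ B := (abs_nonneg _).trans hL'
  have hR0 : 0 ≤ (η * q + a / p) / A := by positivity
  have e4 : (η * q) / A * |L - L'| + a / p / A * |L - L'| =
      (η * q + a / p) / A * |L - L'| := by ring
  have e5 : 0 ≤ a / p / A * |L - L'| := by positivity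
  have e6 : |η * q * (L - L') / A| = (η * q) / A * |L - L'| := by
    rw [mul_div_right_comm, abs_mul, abs_of_pos (div_pos hq hA)]
  have hX0 : a / p / A * |L - L'| ≤ η * D - η * D' + η * q * (L - L') / A := by
    have h1 := (abs_le.1 e1).2
    have h2 := neg_abs_le (η * q * (L - L') / A)
    have h3 : 0 ≤ B * (1 + (η * q + a / p) / A) := by positivity
    linarith
  set x := (η * D - η * D' + η * q * (L - L') / A) / a with hx
  have hx0 : 0 ≤ x := div_nonneg (e5.trans hX0) ha0.le
  have hy0 : 0 ≤ p * x + (L - L') / A := by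
    have h1 : |L - L'| / A ≤ p * x := by
      rw [hx, mul_div_assoc', le_div_iff₀ ha0]
      have := mul_le_mul_of_nonneg_left hX0 hp0.le
      calc |L - L'| / A * a = p * (a / p / A * |L - L'|) := by field_simp
        _ ≤ _ := this
    have h2 := neg_abs_le (L - L')
    have h3 : -(|L - L'| / A) ≤ (L - L') / A := by
      rw [← neg_div]; gcongr
    linarith
  have h := (P.go_F₄ h₄ θ d L D hx0).trans (P.go_F₂ h₂ θ d _ _ hy0)
  rw [← hAdef, ← hqdef, ← hsdef] at h
  have hxa : x * a = η * D - η * D' + η * q * (L - L') / A := div_mul_cancel₀ _ ha0.ne'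
  have hp' : p = -(4 * P.k * s * cos d * q) := by
    rw [hp]; linear_combination -(4 * P.k * s * cos d * q) * hη
  convert h using 2
  · rw [add_zero]
  · have h1 : (L - L') / A * A = L - L' := div_mul_cancel₀ _ hA.ne'
    rw [hp']
    rw [hAdef] at h1 ⊢
    linear_combination h1
  · have h1 : D' = D - η * (x * a) + q * (L - L') / A := by
      rw [hxa]; linear_combination (D - D' + q * (L - L') / A) * hη
    have h2 : η * (x * a) = -(x * (P.k * s * P.inertia (cos d) * P.twist (cos d))) := by
      rw [ha]
      linear_combination -(x * (P.k * s * P.inertia (cos d) * P.twist (cos d))) * hη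
    rw [h1, h2, hp']
    ring

lemma exists_twist_pos_skew_ne_zero (h : ∃ c, P.skew c ≠ 0) :
    ∃ c ∈ Ioo (0 : ℝ) 1, 0 < P.twist c ∧ P.skew c ≠ 0 := by
  have hcont : Continuous P.twist := by unfold twist; fun_prop
  obtain ⟨ε, hε, hball⟩ := Metric.eventually_nhds_iff.1
    (hcont.continuousAt.eventually_const_lt (P.twist_pos_of_nonpos (le_refl (0 : ℝ))))
  have hm : 0 < min ε 1 := lt_min hε one_pos
  have hm1 := min_le_left ε 1
  have hm2 := min_le_right ε 1
  have hpos : ∀ r ∈ Ioo (0 : ℝ) 1, r * min ε 1 ∈ Ioo (0 : ℝ) 1 ∧ 0 < P.twist (r * min ε 1) := by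
    intro r hr
    have h1 : 0 < r * min ε 1 := mul_pos hr.1 hm
    have h2 : r * min ε 1 < min ε 1 := mul_lt_of_lt_one_left hm hr.2
    refine ⟨⟨h1, by linarith⟩, hball ?_⟩
    rw [Real.dist_eq, sub_zero, abs_of_pos h1]
    linarith
  -- an affine function that vanishes at two points vanishes identically
  by_cases h1 : P.skew (1 / 2 * min ε 1) = 0
  · refine ⟨1 / 4 * min ε 1, (hpos _ (by norm_num)).1, (hpos _ (by norm_num)).2, fun h2 => ?_⟩
    obtain ⟨c, hc⟩ := h
    unfold skew push₁ push₂ at h1 h2 hc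
    set b := P.m₂ * P.r₁ * P.r₂ * (P.m₂ - P.m₁) with hb
    have h3 : b * min ε 1 = 0 := by rw [hb]; linear_combination 4 * h1 - 4 * h2
    have h4 : b = 0 := (mul_eq_zero.1 h3).resolve_right hm.ne'
    refine hc ?_
    linear_combination h1 + (c - 1 / 2 * min ε 1) * (h4 - hb)
  · exact ⟨1 / 2 * min ε 1, (hpos _ (by norm_num)).1, (hpos _ (by norm_num)).2, h1⟩

/-- If `skew` vanishes identically, then for `cos δ < 0 < sin δ` the flow of `X₃` turns the plane of
the angular velocities at constant relative angle. -/
lemma exists_go_neg (h₃ : P.F₃ ∈ F) (h : ∀ c, P.skew c = 0) {d : ℝ} (hs : 0 < sin d)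
    (hc : cos d < 0) : ∃ φ, ∀ θ L D, Go F (P.pt θ d L D) (P.pt (θ + φ) d (-L) (-D)) := by
  have hm : P.m₁ = P.m₂ := by
    have h0 := h 0
    have h1 := h 1
    unfold skew push₁ push₂ at h0 h1
    have h2 : P.k * (P.m₂ - P.m₁) = 0 := by unfold k; linear_combination h1 - h0
    linarith [(mul_eq_zero.1 h2).resolve_left P.k_pos.ne']
  have hr : P.r₂ ^ 2 = 2 * P.r₁ ^ 2 := by
    have h0 := h 0
    unfold skew push₁ push₂ at h0
    rw [hm] at h0
    have h2 : P.m₂ ^ 2 * (2 * P.r₁ ^ 2 - P.r₂ ^ 2) = 0 := by linear_combination h0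
    linarith [(mul_eq_zero.1 h2).resolve_left (pow_pos P.m₂_pos 2).ne']
  have m_pos := P.m₂_pos
  have r₁_pos := P.r₁_pos
  have r₂_pos := P.r₂_pos
  have hI := P.inertia_cos_pos d
  set c := cos d with hcdef
  set s := sin d with hsdef
  have hw : P.r₁ * c - P.r₂ < 0 := by
    have := mul_neg_of_pos_of_neg r₁_pos hc
    linarith
  have hp : P.push₁ c < 0 := by
    have e : P.push₁ c = P.m₂ ^ 2 * P.r₂ * (P.r₁ * c - P.r₂) := by
      unfold push₁; rw [hm]; ring
    rw [e]
    exact mul_neg_of_pos_of_neg (by positivity) hw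
  set a := -(2 * s * P.push₁ c) with ha
  have ha0 : 0 < a := by
    have := mul_neg_of_pos_of_neg hs hp
    linarith
  set b := 4 * P.m₂ ^ 3 * P.r₁ ^ 3 * s * P.inertia c * (c * (P.r₁ * c - P.r₂)) with hb
  have hb0 : 0 < b := mul_pos (by positivity) (mul_pos_of_neg_of_neg hc hw)
  set ν := √(a * b) with hν
  have hν2 : ν ^ 2 = a * b := sq_sqrt (by positivity)
  have hν0 : 0 < ν := sqrt_pos.2 (by positivity)
  have hInertia : P.inertia c = 2 * P.m₂ * (2 * P.r₁ ^ 2 + P.r₁ * P.r₂ * c) := by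
    unfold inertia M₁ M₂ k
    rw [hm]
    linear_combination P.m₂ * hr
  have hpush : P.push₂ c = P.push₁ c := by
    have := h c
    unfold skew at this
    linarith
  -- the velocities induced by `X₃` in the coordinates `θ₁`, `θ₂`, `L`, `D`
  have hF : ∀ θ L D, P.F₃ (P.pt θ d L D) = ![-(P.vol c * P.push₁ c), -(P.vol c * P.push₁ c),
      (b * D + (P.k * c + P.M₂) * (-(a * L))) / P.inertia c,
      (b * D - (P.M₁ + P.k * c) * (-(a * L))) / P.inertia c] := fun θ L D => by
    have hI' := hI.ne'
    have h2 : P.pt θ d L D 2 = (L + (P.k * c + P.M₂) * D) / P.inertia c := rfl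
    have h3 : P.pt θ d L D 3 = (L - (P.M₁ + P.k * c) * D) / P.inertia c := rfl
    have hM₁ : P.M₁ + P.k * c = P.inertia c / 2 := by
      rw [hInertia]; unfold M₁ k; rw [hm]; ring
    have hM₂ : P.k * c + P.M₂ = P.inertia c / 2 := by
      rw [hInertia]; unfold M₂ k; linear_combination P.m₂ * hr
    obtain ⟨l, rfl⟩ : ∃ l, L = l * P.inertia c := ⟨L / P.inertia c, by field_simp⟩
    have e1 : (l * P.inertia c + P.inertia c / 2 * D) / P.inertia c = l + D / 2 := by field_simp
    have e2 : (l * P.inertia c - P.inertia c / 2 * D) / P.inertia c = l - D / 2 := by field_simp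
    have e3 : (b * D + P.inertia c / 2 * -(a * (l * P.inertia c))) / P.inertia c =
        4 * P.m₂ ^ 3 * P.r₁ ^ 3 * s * (c * (P.r₁ * c - P.r₂)) * D +
          s * P.push₁ c * l * P.inertia c := by
      rw [ha, hb]; field_simp
    have e4 : (b * D - P.inertia c / 2 * -(a * (l * P.inertia c))) / P.inertia c =
        4 * P.m₂ ^ 3 * P.r₁ ^ 3 * s * (c * (P.r₁ * c - P.r₂)) * D -
          s * P.push₁ c * l * P.inertia c := by
      rw [ha, hb]; field_simp
    rw [F₃_apply, h2, h3, pt_zero, pt_one, sub_sub_cancel, ← hcdef, ← hsdef, hpush, hM₁, hM₂,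
      e1, e2, e3, e4, hInertia]
    ext i
    fin_cases i
    · simp
    · simp
    · simp only [Fin.reduceFinMk, Matrix.cons_val]
      unfold vol k push₁
      rw [hm]
      linear_combination (s * P.m₂ ^ 3 * D * (P.r₂ ^ 2 + 2 * P.r₁ ^ 2 * c ^ 2 -
        2 * P.r₁ * P.r₂ * c) + 2 * s * P.m₂ * l * (P.m₂ ^ 2 * P.r₂ * (P.r₁ * c - P.r₂))) * hr
    · simp only [Fin.reduceFinMk, Matrix.cons_val]
      unfold vol k push₁
      rw [hm]
      linear_combination (s * P.m₂ ^ 3 * D * (2 * P.r₁ ^ 2 * c ^ 2 - P.r₁ * P.r₂ * c)) * hr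
  refine ⟨-(π / ν * (P.vol c * P.push₁ c)), fun θ L D => ?_⟩
  have hγ : IsIntegralCurve (fun t => P.pt (θ - t * (P.vol c * P.push₁ c)) d
      (L * cos (ν * t) + b * D / ν * sin (ν * t))
      (D * cos (ν * t) - a * L / ν * sin (ν * t))) fun _ => P.F₃ := fun t => by
    beta_reduce
    rw [hF]
    have hl : HasDerivAt (fun t => ν * t) ν t := by
      simpa using (hasDerivAt_id t).const_mul ν
    have hL : HasDerivAt (fun t => L * cos (ν * t) + b * D / ν * sin (ν * t))
        (b * (D * cos (ν * t) - a * L / ν * sin (ν * t))) t := by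
      refine hasDerivAt_of_eq ((hl.cos.const_mul L).add (hl.sin.const_mul (b * D / ν)))
        (fun _ => rfl) ?_
      field_simp
      linear_combination L * sin (ν * t) * hν2
    have hD : HasDerivAt (fun t => D * cos (ν * t) - a * L / ν * sin (ν * t))
        (-(a * (L * cos (ν * t) + b * D / ν * sin (ν * t)))) t := by
      refine hasDerivAt_of_eq ((hl.cos.const_mul D).sub (hl.sin.const_mul (a * L / ν)))
        (fun _ => rfl) ?_
      field_simp
      linear_combination D * sin (ν * t) * hν2
    have hθ : HasDerivAt (fun t => θ - t * (P.vol c * P.push₁ c)) (-(P.vol c * P.push₁ c)) t := by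
      simpa using ((hasDerivAt_id t).mul_const (P.vol c * P.push₁ c)).const_sub θ
    refine hasDerivAt_pi.2 fun i => ?_
    fin_cases i
    · exact hθ
    · exact hθ.sub_const d
    · exact (hL.add (hD.const_mul (P.k * c + P.M₂))).div_const _
    · exact (hL.sub (hD.const_mul (P.M₁ + P.k * c))).div_const _
  have hgo := Go.of_curve h₃ hγ (t := π / ν) (by positivity)
  simp only [mul_div_cancel₀ _ hν0.ne', cos_pi, sin_pi, mul_zero, cos_zero, sin_zero, zero_mul,
    sub_zero, add_zero, mul_one, mul_neg] at hgo
  rwa [sub_eq_add_neg] at hgo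

/-- If `skew` vanishes identically, a half turn of the plane of the angular velocities, preceded and
followed by pushes along `X₂` and `X₄`, leads everywhere in that plane. -/
lemma exists_adjustable_of_skew_eq_zero (h₂ : P.F₂ ∈ F) (h₃ : P.F₃ ∈ F) (h₄ : P.F₄ ∈ F)
    (h : ∀ c, P.skew c = 0) : ∃ d φ, P.Adjustable F d 1 φ 0 := by
  have hs : 0 < sin (2 * π / 3) :=
    sin_pos_of_pos_of_lt_pi (by positivity) (by linarith [pi_pos])
  have hc : cos (2 * π / 3) < 0 :=
    cos_neg_of_pi_div_two_lt_of_lt (by linarith [pi_pos]) (by linarith [pi_pos])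
  generalize 2 * π / 3 = d at hs hc
  obtain ⟨φ, hφ⟩ := exists_go_neg h₃ h hs hc
  have hA : 0 < P.k * (P.m₁ + P.m₂) * P.vol (cos d) :=
    mul_pos (mul_pos P.k_pos (add_pos P.m₁_pos P.m₂_pos)) (P.vol_cos_pos d)
  have hB : 0 < P.k * P.inertia (cos d) * (sin d * P.twist (cos d)) :=
    mul_pos (mul_pos P.k_pos (P.inertia_cos_pos d)) (mul_pos hs (P.twist_pos_of_nonpos hc.le))
  have push : ∀ θ L D x y, 0 ≤ x → 0 ≤ y → Go F (P.pt θ d L D) (P.pt θ d (L - x) (D + y)) := by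
    intro θ L D x y hx hy
    have h1 := P.go_F₂ h₂ θ d L D (div_nonneg hx hA.le)
    rw [div_mul_cancel₀ _ hA.ne', h, mul_zero, add_zero] at h1
    have h2 := P.go_launch h₂ h₄ (d := d) (by rw [h, mul_zero]) θ (L - x) D (div_nonneg hy hB.le)
    rw [div_mul_cancel₀ _ hB.ne'] at h2
    exact h1.trans h2
  refine ⟨d, φ, fun B => ⟨0, fun θ L D L' D' _ _ _ _ => ?_⟩⟩
  have h1 := push θ L D (max 0 (L' + L)) (max 0 (-(D' + D))) (le_max_left _ _) (le_max_left _ _)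
  have h2 := hφ θ (L - max 0 (L' + L)) (D + max 0 (-(D' + D)))
  have h3 := push (θ + φ) (-(L - max 0 (L' + L))) (-(D + max 0 (-(D' + D))))
    (max 0 (L' + L) - (L' + L)) (max 0 (-(D' + D)) + (D' + D))
    (by linarith [le_max_right 0 (L' + L)]) (by linarith [le_max_right 0 (-(D' + D))])
  convert h1.trans (h2.trans h3) using 2 <;> ring

variable (P) in
lemma exists_adjustable (h₂ : P.F₂ ∈ F) (h₃ : P.F₃ ∈ F) (h₄ : P.F₄ ∈ F) :
    ∃ d η φ K, η ^ 2 = 1 ∧ 0 ≤ K ∧ P.Adjustable F d η φ K := by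
  by_cases h : ∃ c, P.skew c ≠ 0
  · obtain ⟨c, hc, ht, hq⟩ := exists_twist_pos_skew_ne_zero h
    obtain ⟨η, hη, hηq⟩ : ∃ η : ℝ, η ^ 2 = 1 ∧ 0 < η * P.skew c := by
      rcases hq.lt_or_gt with h | h
      · exact ⟨-1, by norm_num, by linarith⟩
      · exact ⟨1, by norm_num, by linarith⟩
    have hcos : cos (η * -arccos c) = c := by
      rw [cos_mul_of_sq_eq_one hη, cos_neg, cos_arccos (by linarith [hc.1]) hc.2.le]
    obtain ⟨K, hK, hadj⟩ := adjustable_of_skew_ne_zero (F := F) h₂ h₄ (d := η * -arccos c) hη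
      (by
        rw [sin_mul_of_sq_eq_one hη, ← mul_assoc, ← sq, hη, one_mul, sin_neg, sin_arccos,
          neg_lt_zero]
        exact sqrt_pos.2 (by nlinarith [hc.1, hc.2]))
      (by rw [hcos]; exact hc.1) (by rwa [hcos]) (by rwa [hcos])
    exact ⟨_, η, 0, K, hη, hK, hadj⟩
  · push Not at h
    obtain ⟨d, φ, hadj⟩ := exists_adjustable_of_skew_eq_zero h₂ h₃ h₄ h
    exact ⟨d, 1, φ, 0, one_pow 2, le_rfl, hadj⟩

end Params

/-- The time at which a family of functions, increasing at a positive rate, hits a given value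
depends continuously on the parameter. -/
lemma continuousOn_hitting {f : ℝ → ℝ → ℝ} {τ : ℝ → ℝ} {I J : Set ℝ} {m d : ℝ} (hm : 0 < m)
    (hτ : ∀ l ∈ I, τ l ∈ J ∧ f l (τ l) = d)
    (hslope : ∀ l ∈ I, ∀ s ∈ J, ∀ t ∈ J, s ≤ t → m * (t - s) ≤ f l t - f l s)
    (hf : ∀ t ∈ J, ContinuousOn (fun l => f l t) I) : ContinuousOn τ I := by
  intro l₀ hl₀
  rw [ContinuousWithinAt, tendsto_iff_dist_tendsto_zero]
  have h1 : Filter.Tendsto (fun l => dist (f l (τ l₀)) (f l₀ (τ l₀)) / m) (nhdsWithin l₀ I)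
      (nhds 0) := by
    have := (tendsto_iff_dist_tendsto_zero.1 (hf _ (hτ l₀ hl₀).1 l₀ hl₀)).div_const m
    simpa using this
  refine squeeze_zero' (Filter.Eventually.of_forall fun _ => dist_nonneg) ?_ h1
  filter_upwards [self_mem_nhdsWithin] with l hl
  rw [le_div_iff₀ hm, Real.dist_eq, Real.dist_eq, (hτ l₀ hl₀).2, ← (hτ l hl).2]
  rcases le_total (τ l) (τ l₀) with h | h
  · have := hslope l hl _ (hτ l hl).1 _ (hτ l₀ hl₀).1 h
    rw [abs_of_nonpos (by linarith)]
    refine le_trans ?_ (le_abs_self _)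
    linarith
  · have := hslope l hl _ (hτ l₀ hl₀).1 _ (hτ l hl).1 h
    rw [abs_of_nonneg (by linarith)]
    refine le_trans ?_ (neg_le_abs _)
    linarith

namespace Params

variable {P : Params}

/-! ### Adjusting the angles -/

variable (P) in
lemma continuous_pt (θ d D : ℝ) : Continuous fun l => P.pt θ d l D := by
  have hI := (P.inertia_cos_pos d).ne'
  refine continuous_pi fun i => ?_
  fin_cases i
  · exact continuous_const
  · exact continuous_const
  · exact (continuous_id.add continuous_const).div_const _
  · exact (continuous_id.sub continuous_const).div_const _

/-- While the angular momentum is at least `a`, the angle `θ₁`, corrected by the holonomy, advances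
at a positive rate. -/
lemma le_angle_sub_holonomy {z : Coord} {σ a t : ℝ} (ha : 0 ≤ a) (ht : 0 ≤ t)
    (h : ∀ s ∈ Icc 0 t, a ≤ σ * P.angMom (P.traj z s)) :
    P.volMin * a / P.inertiaMax * t ≤
      σ * (P.traj z t 0 - P.holonomy (P.traj z t 0 - P.traj z t 1)) -
        σ * (z 0 - P.holonomy (z 0 - z 1)) := by
  have := mul_sub_le_of_hasDerivAt (C := P.volMin * a / P.inertiaMax) (convex_Icc 0 t)
    (fun s _ => (hasDerivAt_angle_sub_holonomy (hasDerivAt_traj (P := P) z s)).const_mul σ)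
    (fun s hs => ?_) ⟨le_rfl, ht⟩ ⟨ht, le_rfl⟩ ht
  · simpa using this
  · rw [mul_div_assoc', mul_left_comm]
    refine div_le_div₀ (mul_nonneg (P.vol_cos_pos _).le (ha.trans (h s hs))) ?_
      (P.inertia_cos_pos _) (P.inertia_le (cos_le_one _))
    exact mul_le_mul (P.volMin_le (neg_one_le_cos _) (cos_le_one _)) (h s hs) ha
      (P.vol_cos_pos _).le

/-- In the course of one full relative turn, `θ₁` can be changed by any amount in an interval whose
length does not depend on the speed: the angular momentum, which is at our disposal within bounds
proportional to the speed, determines the change. -/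
lemma exists_shift (h₁ : P.F₁ ∈ F) (d : ℝ) {η : ℝ} (hη : η ^ 2 = 1) {K : ℝ} (hK : 0 ≤ K) :
    ∃ φ₀ ε : ℝ, 0 < ε ∧ ∀ M, ∃ B, ∀ θ, ∀ φ ∈ Icc (φ₀ - ε) (φ₀ + ε), ∃ L D L' D', |L| ≤ B ∧
      |D| ≤ B ∧ M ≤ η * D' ∧ K * |L'| ≤ η * D' ∧ Go F (P.pt θ d L D) (P.pt (θ + φ) d L' D') := by
  obtain ⟨c, C, κ, S₁, hc, hC, hκ, hS₁, hrot⟩ := P.exists_rotation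
  have hv := P.volMin_pos
  have hI := P.inertiaMax_pos
  have hpi := pi_pos
  set κ' := min κ (c / (2 * (K + 1))) with hκ'def
  have hκ' : 0 < κ' := lt_min hκ (by positivity)
  have hκκ : κ' ≤ κ := min_le_left _ _
  have hKκ : K * κ' ≤ c / 2 := by
    have h1 : κ' ≤ c / (2 * (K + 1)) := min_le_right _ _
    rw [le_div_iff₀ (by positivity)] at h1
    linarith
  set d' := d + η * (2 * π) with hd'
  refine ⟨P.holonomy d' - P.holonomy d, P.volMin * (κ' / 2) / P.inertiaMax * (2 * π / C),
    by positivity, fun M => ?_⟩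
  set S := max (max S₁ (M / c)) (max (2 * K * C / c) (2 * C / κ')) with hS
  have hSS₁ : S₁ ≤ S := (le_max_left _ _).trans (le_max_left _ _)
  have hSM : M ≤ c * S := (div_le_iff₀' hc).1 ((le_max_right _ _).trans (le_max_left _ _))
  have hSK : 2 * K * C ≤ c * S :=
    (div_le_iff₀' hc).1 ((le_max_left _ _).trans (le_max_right _ _))
  have hSκ : 2 * C ≤ κ' * S :=
    (div_le_iff₀' hκ').1 ((le_max_right _ _).trans (le_max_right _ _))
  have hS0 : 0 < S := hS₁.trans_le hSS₁
  refine ⟨(κ' + 1) * S, fun θ φ hφ => ?_⟩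
  set z : ℝ → Coord := fun l => P.pt θ d l (η * S) with hz
  set I := Icc (-(κ' * S)) (κ' * S) with hIdef
  have hκS : 0 ≤ κ' * S := by positivity
  have hηS : η * (η * S) = S := by rw [← mul_assoc, ← sq, hη, one_mul]
  have hrot' : ∀ l ∈ I, _ := fun l hl => hrot (z l) η hη
    (by rw [hz, pt_gap, hηS]; exact hSS₁) (by
      rw [hz, pt_gap, angMom_pt, hηS]
      exact (abs_le.2 hl).trans (by gcongr))
  simp only [hz, pt_gap, angMom_pt, hηS] at hrot'
  have hτ : ∀ l ∈ I, ∃ t ∈ Icc (0 : ℝ) 1, P.traj (z l) t 0 - P.traj (z l) t 1 = d' := fun l hl =>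
    (hrot' l hl).2.2 d' (by
      simp only [hd', pt_zero, pt_one, sub_sub_cancel, add_sub_cancel_left]
      rw [← mul_assoc, ← sq, hη, one_mul]
      exact ⟨by positivity, le_rfl⟩)
  choose! τ hτ01 hτd using hτ
  have hτ0 : ∀ l ∈ I, 2 * π / (C * S) ≤ τ l := fun l hl => by
    have h1 := ((hrot' l hl).2.1 0 ⟨le_rfl, zero_le_one⟩ (τ l) (hτ01 l hl) (hτ01 l hl).1).2
    rw [div_le_iff₀' (by positivity)]
    have h2 := hτd l hl
    simp only [hz] at h2
    rw [h2, hd'] at h1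
    simp only [traj_zero, pt_zero, pt_one, sub_sub_cancel, sub_zero] at h1
    have h3 : η * (d + η * (2 * π)) - η * d = 2 * π := by linear_combination 2 * π * hη
    linarith
  have hτc : ContinuousOn τ I := by
    refine continuousOn_hitting (f := fun l t => η * (P.traj (z l) t 0 - P.traj (z l) t 1))
      (J := Icc 0 1) (m := c * S) (d := η * d') (by positivity)
      (fun l hl => ⟨hτ01 l hl, by rw [hτd l hl]⟩)
      (fun l hl s hs t ht hst => ((hrot' l hl).2.1 s hs t ht hst).1) (fun t ht => ?_)
    have h1 : ContinuousOn (fun l => P.traj (z l) t) I :=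
      (continuousOn_traj (P := P)).comp (f := fun l => (z l, t))
        ((P.continuous_pt θ d (η * S)).prodMk continuous_const).continuousOn
        fun l _ => ⟨mem_univ _, ht.1⟩
    have h2 := continuousOn_pi.1 h1
    exact ((h2 0).sub (h2 1)).const_smul η
  have hΘc : ContinuousOn (fun l => P.traj (z l) (τ l) 0 - θ) I := by
    have h1 : ContinuousOn (fun l => P.traj (z l) (τ l)) I :=
      (continuousOn_traj (P := P)).comp (f := fun l => (z l, τ l))
        ((P.continuous_pt θ d (η * S)).continuousOn.prodMk hτc)
        fun l hl => ⟨mem_univ _, (hτ01 l hl).1⟩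
    exact (continuousOn_pi.1 h1 0).sub continuousOn_const
  have hend : ∀ σ : ℝ, σ ^ 2 = 1 → P.volMin * (κ' / 2) / P.inertiaMax * (2 * π / C) ≤
      σ * (P.traj (z (σ * (κ' * S))) (τ (σ * (κ' * S))) 0 - θ -
        (P.holonomy d' - P.holonomy d)) := by
    intro σ hσ
    have hl : σ * (κ' * S) ∈ I := by
      rcases eq_one_or_neg_one hσ with rfl | rfl <;> constructor <;> linarith
    have h1 := le_angle_sub_holonomy (P := P) (z := z (σ * (κ' * S))) (σ := σ) (a := κ' * S / 2)
      (t := τ (σ * (κ' * S))) (by positivity) (hτ01 _ hl).1 (fun s hs => by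
        have h2 := abs_le.1 ((hrot' _ hl).1 s ⟨hs.1, hs.2.trans (hτ01 _ hl).2⟩).2
        rcases eq_one_or_neg_one hσ with rfl | rfl <;> simp only [hz] <;> linarith [h2.1, h2.2])
    rw [hτd _ hl] at h1
    have h2 : P.volMin * (κ' / 2) / P.inertiaMax * (2 * π / C) ≤
        P.volMin * (κ' * S / 2) / P.inertiaMax * τ (σ * (κ' * S)) := by
      calc P.volMin * (κ' / 2) / P.inertiaMax * (2 * π / C)
          = P.volMin * (κ' * S / 2) / P.inertiaMax * (2 * π / (C * S)) := by field_simp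
        _ ≤ _ := by gcongr; exact hτ0 _ hl
    simp only [hz, pt_zero, pt_one, sub_sub_cancel] at h1 ⊢
    linarith
  obtain ⟨l, hl, hlφ⟩ := intermediate_value_Icc (by linarith) hΘc
    (show φ ∈ Icc (P.traj (z (-(κ' * S))) (τ (-(κ' * S))) 0 - θ)
      (P.traj (z (κ' * S)) (τ (κ' * S)) 0 - θ) by
      have h1 := hend 1 (one_pow 2)
      have h2 := hend (-1) (by norm_num)
      rw [one_mul, one_mul] at h1
      rw [neg_one_mul, neg_one_mul] at h2
      constructor <;> linarith [hφ.1, hφ.2])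
  obtain ⟨h1, h2⟩ := (hrot' l hl).1 (τ l) (hτ01 l hl)
  have hlS : |l| ≤ κ' * S := abs_le.2 hl
  refine ⟨l, η * S, P.angMom (P.traj (z l) (τ l)), P.traj (z l) (τ l) 2 - P.traj (z l) (τ l) 3,
    by linarith, ?_, hSM.trans h1, ?_, (go_traj h₁ (z l) (hτ01 l hl).1).trans (.of_toState_eq ?_)⟩
  · rw [abs_mul, (abs_eq zero_le_one).2 (eq_one_or_neg_one hη), one_mul, abs_of_pos hS0]
    linarith
  · refine le_trans ?_ h1
    have h3 := abs_sub_abs_le_abs_sub (P.angMom (P.traj (z l) (τ l))) l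
    have h4 : |P.angMom (P.traj (z l) (τ l))| ≤ κ' * S + C := by linarith
    calc K * |P.angMom (P.traj (z l) (τ l))| ≤ K * (κ' * S + C) := by gcongr
      _ = K * κ' * S + K * C := by ring
      _ ≤ c / 2 * S + K * C := by gcongr
      _ ≤ c * S := by linarith
  · obtain ⟨n, hn⟩ : ∃ n : ℤ, (n : ℝ) = η := by
      rcases eq_one_or_neg_one hη with rfl | rfl
      exacts [⟨1, by simp⟩, ⟨-1, by simp⟩]
    have h3 := P.toState_pt_add_two_pi (θ + φ) d (P.angMom (P.traj (z l) (τ l)))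
      (P.traj (z l) (τ l) 2 - P.traj (z l) (τ l) 3) 0 n
    have h4 : θ + φ = P.traj (z l) (τ l) 0 := by
      have hlφ : P.traj (z l) (τ l) 0 - θ = φ := hlφ
      linarith
    rw [← h3, hn, ← hd', ← hτd l hl, Int.cast_zero, zero_mul, add_zero, h4, ← P.eq_pt]

/-! ### Controllability -/

/-- Repeated turns, with an adjustment of the angular velocities after each of them, lead from
every fast enough rotation to a given point. -/
lemma exists_go_of_fast (h₁ : P.F₁ ∈ F) {d η φ K : ℝ} (hη : η ^ 2 = 1) (hK : 0 ≤ K)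
    (hadj : P.Adjustable F d η φ K) (θ' L' D' : ℝ) :
    ∃ S, ∀ θ L D, S ≤ η * D → K * |L| ≤ η * D → Go F (P.pt θ d L D) (P.pt θ' d L' D') := by
  obtain ⟨φ₀, ε, hε, hshift⟩ := exists_shift h₁ d hη hK
  -- after `n` turns, all the angles of an interval of length `2 n ε` are taken care of
  have key : ∀ n : ℕ, ∃ a b, b - a = 2 * n * ε ∧ ∃ S, ∀ θ ∈ Icc a b, ∀ L D, S ≤ η * D →
      K * |L| ≤ η * D → Go F (P.pt θ d L D) (P.pt θ' d L' D') := by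
    intro n
    induction n with
    | zero =>
      obtain ⟨S, hS⟩ := hadj (max |L'| |D'|)
      refine ⟨θ' - φ, θ' - φ, by simp, S, fun θ hθ L D h1 h2 => ?_⟩
      have h3 := hS θ L D L' D' (le_max_left _ _) (le_max_right _ _) h1 h2
      rwa [show θ + φ = θ' by linarith [hθ.1, hθ.2]] at h3
    | succ n ih =>
      obtain ⟨a, b, hab, S, hS⟩ := ih
      have hle : a ≤ b := by
        have : 0 ≤ 2 * n * ε := by positivity
        linarith
      obtain ⟨B, hB⟩ := hshift S
      obtain ⟨S', hS'⟩ := hadj B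
      refine ⟨a - φ₀ - ε - φ, b - φ₀ + ε - φ, by push_cast; linarith, S',
        fun θ hθ L D h1 h2 => ?_⟩
      obtain ⟨ψ, hψ, hψ'⟩ : ∃ ψ ∈ Icc (φ₀ - ε) (φ₀ + ε), θ + φ + ψ ∈ Icc a b := by
        rcases le_total (θ + φ + φ₀) a with h | h
        · exact ⟨a - (θ + φ), ⟨by linarith, by linarith [hθ.1]⟩, by linarith, by linarith⟩
        rcases le_total (θ + φ + φ₀) b with h' | h'
        · exact ⟨φ₀, ⟨by linarith, by linarith⟩, h, h'⟩
        · exact ⟨b - (θ + φ), ⟨by linarith [hθ.2], by linarith⟩, by linarith, by linarith⟩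
      obtain ⟨L₁, D₁, L₂, D₂, hL₁, hD₁, hD₂, hL₂, hgo⟩ := hB (θ + φ) ψ hψ
      exact (hS' θ L D L₁ D₁ hL₁ hD₁ h1 h2).trans (hgo.trans (hS _ hψ' L₂ D₂ hD₂ hL₂))
  obtain ⟨n, hn⟩ := exists_nat_ge (π / ε)
  obtain ⟨a, b, hab, S, hS⟩ := key n
  rw [div_le_iff₀ hε] at hn
  refine ⟨S, fun θ L D h1 h2 => ?_⟩
  obtain ⟨m, hm⟩ := exists_int_mul_sub_mem (one_pow 2) a θ
  rw [one_mul] at hm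
  have hgo := go_add_two_pi (P := P) F θ d L D m 0
  rw [Int.cast_zero, zero_mul, add_zero] at hgo
  exact hgo.trans (hS _ ⟨by linarith [hm.1], by linarith [hm.2]⟩ L D h1 h2)

/-- Every point can be led to every other one: time reversal turns the approach of a relative angle
into a departure from it. -/
theorem go_of_mem (h₁ : P.F₁ ∈ F) (h₂ : P.F₂ ∈ F) (h₃ : P.F₃ ∈ F) (h₄ : P.F₄ ∈ F) (z w : Coord) :
    Go F z w := by
  obtain ⟨d, η, φ, K, hη, hK, hadj⟩ := P.exists_adjustable h₂ h₃ h₄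
  obtain ⟨θ', L', D', -, -, hback⟩ := exists_go_fast (P := P) (F := {P.F₁, P.F₂, P.F₄})
    (by simp) (by simp) (by simp) (reverse w) d hη hK 0
  have hout := hback.reverse fun X hX z => by
    rcases hX with rfl | rfl | rfl
    · rw [F₁_apply, F₁_apply]
      ext i
      fin_cases i <;> simp [reverse, acc₁, acc₂]
      ring
    · rw [F₂_apply, F₂_apply]
      ext i
      fin_cases i <;> simp [reverse]
    · rw [F₄_apply, F₄_apply]
      ext i
      fin_cases i <;> simp [reverse]
  rw [reverse_reverse, reverse_pt] at hout
  obtain ⟨S, hS⟩ := exists_go_of_fast h₁ hη hK hadj θ' (-L') (-D')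
  obtain ⟨θ, L, D, hD, hL, hin⟩ := exists_go_fast h₁ h₂ h₄ z d hη hK S
  refine hin.trans ((hS θ L D hD hL).trans (hout.mono ?_))
  rintro X (rfl | rfl | rfl) <;> assumption

end Params

end Pendulum

theorem mainTheorem3 (m₁ m₂ r₁ r₂ g : ℝ) (hm₁ : 0 < m₁) (hm₂ : 0 < m₂) (hr₁ : 0 < r₁)
    (hr₂ : 0 < r₂) (hg : 0 < g)
    (hF : Pendulum.IsBracketGenerating (Pendulum.family m₁ m₂ r₁ r₂ g)) :
    ∀ p : Pendulum.State,
      Pendulum.attainableSet (Pendulum.family m₁ m₂ r₁ r₂ g) p =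
        Pendulum.orbit (Pendulum.family m₁ m₂ r₁ r₂ g) p := by
  have surj : ∀ p : Pendulum.State, ∃ z, Pendulum.toState z = p := by
    rintro ⟨a, b, x, y⟩
    induction a using Real.Angle.induction_on with | _ a
    induction b using Real.Angle.induction_on with | _ b
    exact ⟨![a, b, x, y], rfl⟩
  intro p
  refine Set.Subset.antisymm (fun q hq => ?_) fun q _ => ?_
  · refine Relation.ReflTransGen.mono ?_ _ _ hq
    rintro a b ⟨X, hX, t, -, h⟩
    exact ⟨X, hX, t, h⟩
  · obtain ⟨z, rfl⟩ := surj p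
    obtain ⟨w, rfl⟩ := surj q
    exact Pendulum.Params.go_of_mem (P := ⟨m₁, m₂, r₁, r₂, g, hm₁, hm₂, hr₁, hr₂, hg⟩)
      (.inl rfl) (.inr (.inl rfl)) (.inr (.inr (.inl rfl))) (.inr (.inr (.inr rfl))) z w
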